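/- Consider a binary one-dimensional cellular automaton with finite neighborhood $\mathcal N\subset\mathbb Z$, local update function $\phi:\{0,1\}^{\mathcal N}\to\{0,1\}$ and global map $\Phi(\eta)(x)=\phi\big((\eta(x+v))_{v\in\mathcal N}\big)$, and let $\xi_t=\Phi^t(\eta)$ be its trajectory from the initial state $\xi_0=\eta\in\{0,1\}^{\mathbb Z}$. For a configuration $\xi$ let $\xi^{(y)}$ be $\xi$ with the state at $y$ flipped. Given an initial defect configuration $\Delta_0:\mathbb Z\to\mathbb Z_{\ge 0}$ of finite support, let $$\Delta_{t+1}(x)=\sum_{y\in x+\mathcal N}\mathbf 1\big(\Phi(\xi_t^{(y)})(x)\ne\xi_{t+1}(x)\big)\,\Delta_t(y).$$ The Lyapunov profile $L:\mathbb R\to[-\infty,\infty)$ is $$L(\alpha)=\lim_{\epsilon\downarrow0}\limsup_{t\to\infty}\frac1t\log\Big(\sum_{x:|x/t-\alpha|<\epsilon}\Delta_t(x)\Big)\qquad(\log 0=-\infty),$$ and it is called proper if replacing $\limsup$ by $\liminf$ gives the same limit for every $\alpha$. Let $\eta$ be doubly periodic, that is, $\Phi^\pi(\eta)=\eta$ for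 some $\pi\ge1$ and $\eta(x)=\eta(x\bmod\sigma)$ for all $x$, for some $\sigma\ge1$; take $\sigma$ to be the smallest such number. Let $\pi_0\ge1$ be the smallest time for which there is a shift $\sigma_0\in\{0,\dots,\sigma-1\}$ with $\Phi^{\pi_0}(\eta)(x)=\eta(x-\sigma_0)$ for all $x$. The expansion graph has vertex set $\{0,\dots,\sigma-1\}$. For each vertex $i$ and each $D\in\mathbb Z$ such that the defect dynamics started from a single defect at $i$ has $N:=\Delta_{\pi_0}(i+D)>0$, it has one edge $e$ from $i$ to $(i+D-\sigma_0)\bmod\sigma$, with displacement label $D(e)=D$ and size label $N(e)=N$. Let $e_1,\dots,e_{d_T}$ be the edges, and let $T$ be the $d_T\times d_T$ matrix with $T_{k\ell}=N(e_k)$ if $e_k$ ends at the vertex from which $e_\ell$ originates, and $T_{k\ell}=0$ otherwise. Write $k\leadsto\ell$ if $k=\ell$ or $(T^n)_{k\ell}>0$ for some $n$. Let - $B_0$ be the set of $b\in\{1,\dots,d_T\}$ such that $e_b$ originates from $x\bmod\sigma$ for some $x$ with $\Delta_0(x)>0$; - $\mathcal P$ be the set of probability measures on $\{1,\dots,d_T\}$,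 and $\mathcal P_a=\{\mu\in\mathcal P:\sum_k\mu_kD(e_k)=a\}$ for $a\in\mathbb R$; - $\mathcal P'_b$ be the set of $\mu\in\mathcal P$ such that, for all $k,\ell$: if $b\not\leadsto k$ then $\mu_k=0$, and if $\ell\not\leadsto k$ and $k\not\leadsto\ell$ then $\mu_k\mu_\ell=0$; - $\mathcal K_\mu$ be the set of $d_T\times d_T$ stochastic matrices $q$ (nonnegative entries, row sums $1$) with $\sum_k\mu_kq_{k\ell}=\mu_\ell$ for all $\ell$; - $H(q,\mu)=\sum_{k,\ell}\mu_kq_{k\ell}\log\frac{T_{k\ell}}{q_{k\ell}}$, where a term with $\mu_kq_{k\ell}=0$ is $0$ and a term with $\mu_kq_{k\ell}>0$, $T_{k\ell}=0$ is $-\infty$. Theorem. For every such automaton, every doubly periodic $\eta$ (possibly reducible) and every $\Delta_0$ of finite support, the Lyapunov profile is proper, and for every $\alpha\in\mathbb R$ $$L(\alpha)=\frac1{\pi_0}\,\sup_{b\in B_0}\ \sup_{\mu\in\mathcal P_{\pi_0\alpha}\cap\mathcal P'_b}\ \sup_{q\in\mathcal K_\mu}H(q,\mu),\qquad \sup\emptyset=-\infty.$$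 -/

import Mathlib

open Filter Topology
open scoped ENNReal

/-- A binary one-dimensional cellular automaton: a finite neighborhood in `ℤ` and a local update
function of the states on the neighborhood. -/
structure CellularAutomaton where
  nbhd : Finset ℤ
  rule : (nbhd → Bool) → Bool

namespace CellularAutomaton

/-- The global map `Φ`. -/
def globalMap (A : CellularAutomaton) (η : ℤ → Bool) : ℤ → Bool :=
  fun x => A.rule (fun v => η (x + v))

/-- The trajectory `ξ_t`, started from `ξ_0 = η`. -/
def traj (A : CellularAutomaton) (η : ℤ → Bool) (t : ℕ) : ℤ → Bool :=
  A.globalMap^[t] η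

/-- The perturbation of the configuration `η` at the site `y`. -/
def perturb (η : ℤ → Bool) (y : ℤ) : ℤ → Bool :=
  Function.update η y (!η y)

/-- `change_t(y, x)` equals `1` if the perturbation of `ξ_t` at `y` changes the state at `x` at
time `t + 1`, and `0` otherwise. -/
def change (A : CellularAutomaton) (η : ℤ → Bool) (t : ℕ) (y x : ℤ) : ℕ :=
  if A.globalMap (perturb (A.traj η t) y) x ≠ A.traj η (t + 1) x then 1 else 0

/-- The defect configuration `Δ_t`, for the initial CA state `η` and initial defects `Δ₀`. -/
def defect (A : CellularAutomaton) (η : ℤ → Bool) (Δ₀ : ℤ → ℕ) : ℕ → ℤ → ℕ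
  | 0 => Δ₀
  | t + 1 => fun x => ∑ v ∈ A.nbhd, A.change η t (x + v) x * A.defect η Δ₀ t (x + v)

/-! ### Lyapunov profiles -/

/-- The number of defects at the sites `x` with `|x / t - α| < ε` at time `t`. -/
noncomputable def defectCount (A : CellularAutomaton) (η : ℤ → Bool) (Δ₀ : ℤ → ℕ)
    (α ε : ℝ) (t : ℕ) : ℝ≥0∞ :=
  ∑' x : {x : ℤ // |(x : ℝ) / (t : ℝ) - α| < ε}, (A.defect η Δ₀ t x : ℝ≥0∞)

/-- `t⁻¹ log (∑_{x : |x/t - α| < ε} Δ(x, t))`, where `log 0 = -∞`. -/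
noncomputable def growthRate (A : CellularAutomaton) (η : ℤ → Bool) (Δ₀ : ℤ → ℕ)
    (α ε : ℝ) (t : ℕ) : EReal :=
  ENNReal.log (A.defectCount η Δ₀ α ε t) / (t : EReal)

/-- `L` is the Lyapunov profile: `L α = lim_{ε ↓ 0} limsup_{t → ∞} t⁻¹ log (∑ Δ(x, t))`. -/
def HasLyapunovProfile (A : CellularAutomaton) (η : ℤ → Bool) (Δ₀ : ℤ → ℕ)
    (L : ℝ → EReal) : Prop :=
  ∀ α : ℝ, Tendsto (fun ε : ℝ => limsup (A.growthRate η Δ₀ α ε) atTop) (𝓝[>] 0) (𝓝 (L α))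

/-- The Lyapunov profile is proper: `limsup` and `liminf` give the same limit for every `α`. -/
def IsProper (A : CellularAutomaton) (η : ℤ → Bool) (Δ₀ : ℤ → ℕ) : Prop :=
  ∀ α : ℝ, ∃ l : EReal,
    Tendsto (fun ε : ℝ => limsup (A.growthRate η Δ₀ α ε) atTop) (𝓝[>] 0) (𝓝 l) ∧
    Tendsto (fun ε : ℝ => liminf (A.growthRate η Δ₀ α ε) atTop) (𝓝[>] 0) (𝓝 l)

/-! ### Doubly periodic states -/

/-- `η` is doubly periodic: periodic in time under the CA, and periodic in space. -/
def IsDoublyPeriodic (A : CellularAutomaton) (η : ℤ → Bool) : Prop :=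
  (∃ p : ℕ, 1 ≤ p ∧ A.globalMap^[p] η = η) ∧
    ∃ s : ℕ, 1 ≤ s ∧ ∀ x : ℤ, η x = η (x % (s : ℤ))

/-- The spatial period `σ`. -/
noncomputable def spatialPeriod (η : ℤ → Bool) : ℕ :=
  sInf {s : ℕ | 1 ≤ s ∧ ∀ x : ℤ, η x = η (x % (s : ℤ))}

/-- In `p` steps the CA shifts `η` to the right by `s`. -/
def ShiftsBy (A : CellularAutomaton) (η : ℤ → Bool) (p s : ℕ) : Prop :=
  ∀ x : ℤ, (A.globalMap^[p] η) x = η (x - (s : ℤ))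

/-- The shift period `π₀`: the least `p ≥ 1` such that `η` is shifted to the right in `p` steps by
some `s ∈ {0, …, σ - 1}`. -/
noncomputable def shiftPeriod (A : CellularAutomaton) (η : ℤ → Bool) : ℕ :=
  sInf {p : ℕ | 1 ≤ p ∧ ∃ s < spatialPeriod η, A.ShiftsBy η p s}

/-- The shift `σ₀ ∈ {0, …, σ - 1}` over one shift period (it is unique, as `σ` is minimal). -/
noncomputable def shift (A : CellularAutomaton) (η : ℤ → Bool) : ℕ :=
  sInf {s : ℕ | s < spatialPeriod η ∧ A.ShiftsBy η (A.shiftPeriod η) s}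

/-! ### The expansion graph -/

/-- The value at `i + D`, at time `π₀`, of the defect configuration that starts from a single
defect at `i`. -/
noncomputable def offspring (A : CellularAutomaton) (η : ℤ → Bool) (i D : ℤ) : ℕ :=
  A.defect η (Pi.single i 1) (A.shiftPeriod η) (i + D)

/-- The edges of the expansion graph. Its vertices are `0, …, σ - 1`, and an edge is determined by
the vertex `i` it originates from and its displacement label `D`: there is one such edge whenever
a single defect at `i` results in a nonzero number of defects at `i + D` at time `π₀`. -/
def Edge (A : CellularAutomaton) (η : ℤ → Bool) : Type :=
  {e : Fin (spatialPeriod η) × ℤ // A.offspring η ((e.1 : ℕ) : ℤ) e.2 ≠ 0}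

variable {A : CellularAutomaton} {η : ℤ → Bool}

/-- The vertex from which the edge originates. -/
def Edge.source (e : A.Edge η) : ℤ := ((e.1.1 : ℕ) : ℤ)

/-- The displacement label `D(e)`. -/
def Edge.disp (e : A.Edge η) : ℤ := e.1.2

/-- The size label `N(e)`. -/
noncomputable def Edge.size (e : A.Edge η) : ℕ := A.offspring η e.source e.disp

/-- The vertex `i + D(e) - σ₀ mod σ` at which the edge from `i` ends. -/
noncomputable def Edge.target (e : A.Edge η) : ℤ :=
  (e.source + e.disp - (A.shift η : ℤ)) % (spatialPeriod η : ℤ)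

theorem defect_support_finite (A : CellularAutomaton) (η : ℤ → Bool) (Δ₀ : ℤ → ℕ)
    (h : Δ₀.support.Finite) (t : ℕ) : (A.defect η Δ₀ t).support.Finite := by
  induction t with
  | zero => exact h
  | succ t ih =>
    refine (Set.Finite.biUnion A.nbhd.finite_toSet
      (fun v _ => ih.image (fun y => y - v))).subset ?_
    intro x hx
    obtain ⟨v, hv, hne⟩ := Finset.exists_ne_zero_of_sum_ne_zero hx
    exact Set.mem_biUnion (Finset.mem_coe.2 hv)
      ⟨x + v, right_ne_zero_of_mul hne, by simp⟩

instance Edge.finite (A : CellularAutomaton) (η : ℤ → Bool) : Finite (A.Edge η) := by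
  have h : ∀ i : ℤ, {D : ℤ | A.offspring η i D ≠ 0}.Finite := fun i =>
    Set.Finite.preimage (f := fun D : ℤ => i + D) (fun _ _ _ _ hab => by simpa using hab)
      (A.defect_support_finite η (Pi.single i 1)
        ((Set.finite_singleton i).subset Pi.support_single_subset) (A.shiftPeriod η))
  have h2 : {e : Fin (spatialPeriod η) × ℤ | A.offspring η ((e.1 : ℕ) : ℤ) e.2 ≠ 0}.Finite := by
    refine (Set.finite_iUnion (fun i : Fin (spatialPeriod η) =>
      (h ((i : ℕ) : ℤ)).image (fun D => (i, D)))).subset ?_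
    rintro ⟨i, D⟩ he
    exact Set.mem_iUnion.2 ⟨i, D, he, rfl⟩
  exact h2.to_subtype

noncomputable instance Edge.fintype (A : CellularAutomaton) (η : ℤ → Bool) :
    Fintype (A.Edge η) := Fintype.ofFinite _

noncomputable instance Edge.decidableEq (A : CellularAutomaton) (η : ℤ → Bool) :
    DecidableEq (A.Edge η) := Classical.decEq _

/-- The matrix `T`, indexed by the edges. -/
noncomputable def edgeMatrix (A : CellularAutomaton) (η : ℤ → Bool) :
    Matrix (A.Edge η) (A.Edge η) ℕ :=
  fun k l => if k.target = l.source then k.size else 0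

/-- `k ⇝ l`. -/
def Leads (A : CellularAutomaton) (η : ℤ → Bool) (k l : A.Edge η) : Prop :=
  k = l ∨ ∃ n : ℕ, 0 < (A.edgeMatrix η ^ n) k l

/-- `B₀`: the edges that originate from `x mod σ` for some `x` with a defect in `Δ₀`. -/
def initialEdges (A : CellularAutomaton) (η : ℤ → Bool) (Δ₀ : ℤ → ℕ) : Set (A.Edge η) :=
  {b | ∃ x : ℤ, Δ₀ x ≠ 0 ∧ b.source = x % (spatialPeriod η : ℤ)}

/-- The probability measures `μ` on the edges with mean displacement `a`. -/
def edgeDistributions (A : CellularAutomaton) (η : ℤ → Bool) (a : ℝ) : Set (A.Edge η → ℝ) :=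
  {μ | (∀ k, 0 ≤ μ k) ∧ ∑ k, μ k = 1 ∧ ∑ k, μ k * (k.disp : ℝ) = a}

/-- The reachability constraints (on `μ`) for the initial edge `b`. -/
def reachable (A : CellularAutomaton) (η : ℤ → Bool) (b : A.Edge η) : Set (A.Edge η → ℝ) :=
  {μ | ∀ k l, (¬ A.Leads η b k → μ k = 0) ∧
    (¬ A.Leads η l k → ¬ A.Leads η k l → μ k * μ l = 0)}

/-- The stochastic matrices that leave `μ` invariant. -/
def invariantKernels (A : CellularAutomaton) (η : ℤ → Bool) (μ : A.Edge η → ℝ) :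
    Set (Matrix (A.Edge η) (A.Edge η) ℝ) :=
  {q | (∀ k l, 0 ≤ q k l) ∧ (∀ k, ∑ l, q k l = 1) ∧ ∀ l, ∑ k, μ k * q k l = μ l}

/-- `H(q, μ) = ∑ μ_k q_{kl} log (T_{kl} / q_{kl})`, with the usual conventions: a term with
`μ_k q_{kl} = 0` is `0`, and a term with `μ_k q_{kl} > 0` and `T_{kl} = 0` is `-∞`. -/
noncomputable def entropy (A : CellularAutomaton) (η : ℤ → Bool)
    (q : Matrix (A.Edge η) (A.Edge η) ℝ) (μ : A.Edge η → ℝ) : EReal :=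
  ∑ k, ∑ l,
    if μ k * q k l = 0 then 0
    else if A.edgeMatrix η k l = 0 then ⊥
    else ((μ k * q k l * Real.log ((A.edgeMatrix η k l : ℝ) / q k l) : ℝ) : EReal)

end CellularAutomaton

/-! Over one shift period `π₀` the automaton only translates `η`. The defect dynamics is linear in
the initial defects and commutes with translations, so the defects at time `(n + 1)π₀` descending
from one site are a sum over paths of `n + 1` edges in the expansion graph. A path counts with the
product of its size labels, at the site reached by adding its displacement labels
(`defect_eq_sum_paths`). It remains to show that the total weight of paths with drift near `a = π₀α`
grows at the largest entropy `H(q, μ)` among the admissible stationary chains of drift `a`.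

Upper bound, by the method of types: paths with the same step counts have total weight at most the
exponential of the entropy of these counts (`sum_weight_stepCount_le`), and there are only
polynomially many count vectors. The step frequencies of a long path are almost invariant and
satisfy the reachability constraints exactly. By compactness (`exists_forall_pairEntropy_lt`) almost
invariant measures may be replaced by invariant ones, which are the stationary chains
(`exists_isStationaryOn`).

Lower bound: an optimal chain may charge several communicating classes, so typical paths of the
chain need not have the right drift. Instead, group the paths of a fixed large length `n` by ends
and displacement. Gibbs' inequality bounds `n H` by the mean logarithm of the class weights, up to
`O(log n)` (`entropy_le`). Every step of a stationary chain can be undone (`accessible_of_step`), so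
each class is closed to loops by a return walk of bounded length. The base points are pairwise
comparable and reachable from `b`, so the loops can be run through one after the other, each with
multiplicity proportional to its probability (`exists_walkWeight_prod`,
`exists_walkWeight_frequencies`). This produces the required drift and weight.

At other times, finite propagation speed compares the defects with those at a neighbouring multiple
of `π₀`, at the cost of a bounded factor and a slightly wider window. All bounds hold for every
large time, so they control limsup and liminf alike. -/

set_option linter.unusedSectionVars false

/-! ### Paths over a finite alphabet -/

/-- The continuations by `n` steps of a path in the alphabet `E`. -/
inductive PathTail (E : Type) : ℕ → Type
  | nil : PathTail E 0
  | cons {n : ℕ} (k : E) (p : PathTail E n) : PathTail E (n + 1)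

namespace PathTail

variable {E : Type}

/-- A path is its first step followed by the other steps. -/
def consEquiv (E : Type) (n : ℕ) : E × PathTail E n ≃ PathTail E (n + 1) where
  toFun x := cons x.1 x.2
  invFun
    | cons k p => (k, p)
  left_inv _ := rfl
  right_inv
    | cons _ _ => rfl

/-- There is one path of no steps. -/
def unitEquiv (E : Type) : Unit ≃ PathTail E 0 where
  toFun _ := nil
  invFun _ := ()
  left_inv _ := rfl
  right_inv
    | nil => rfl

instance fintype [Fintype E] : (n : ℕ) → Fintype (PathTail E n)
  | 0 => Fintype.ofEquiv Unit (unitEquiv E)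
  | n + 1 =>
    haveI := fintype n
    Fintype.ofEquiv (E × PathTail E n) (consEquiv E n)

/-- The last point of a path that starts at `k`. -/
def last : {n : ℕ} → E → PathTail E n → E
  | _, k, nil => k
  | _, _, cons j p => last j p

/-- The product of `M` over the steps of a path that starts at `k`. -/
def weight {R : Type} [CommSemiring R] (M : E → E → R) : {n : ℕ} → E → PathTail E n → R
  | _, _, nil => 1
  | _, k, cons j p => M k j * weight M j p

/-- The sum of `f` over the steps of a path that starts at `k`. -/
def total {R : Type} [AddCommMonoid R] (f : E → E → R) : {n : ℕ} → E → PathTail E n → R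
  | _, _, nil => 0
  | _, k, cons j p => f k j + total f j p

section
variable {R : Type} [CommSemiring R] (M : E → E → R) {n : ℕ} (k j : E) (p : PathTail E n)

@[simp] theorem last_nil : last k nil = k := rfl
@[simp] theorem last_cons : last k (cons j p) = last j p := rfl
@[simp] theorem weight_nil : weight M k nil = 1 := rfl
@[simp] theorem weight_cons : weight M k (cons j p) = M k j * weight M j p := rfl

end

@[simp] theorem total_nil {R : Type} [AddCommMonoid R] (f : E → E → R) (k : E) :
    total f k nil = 0 := rfl
@[simp] theorem total_cons {R : Type} [AddCommMonoid R] (f : E → E → R) {n : ℕ} (k j : E)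
    (p : PathTail E n) : total f k (cons j p) = f k j + total f j p := rfl

theorem sum_zero [Fintype E] {R : Type} [AddCommMonoid R] (F : PathTail E 0 → R) :
    ∑ p, F p = F nil := by
  rw [← (unitEquiv E).sum_comp]
  simp [unitEquiv]

theorem sum_succ [Fintype E] {R : Type} [AddCommMonoid R] {n : ℕ}
    (F : PathTail E (n + 1) → R) :
    ∑ p, F p = ∑ l : E, ∑ p : PathTail E n, F (cons l p) := by
  rw [← (consEquiv E n).sum_comp, Fintype.sum_prod_type]
  rfl

theorem weight_nonneg {M : E → E → ℝ} (hM : ∀ k l, 0 ≤ M k l) {n : ℕ} (k : E)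
    (p : PathTail E n) : 0 ≤ weight M k p := by
  induction p generalizing k with
  | nil => simp
  | cons j p ih => exact mul_nonneg (hM _ _) (ih _)

/-- Row sums below one are allowed because the empirical kernel of a path vanishes on the rows of
points that the path never leaves. -/
theorem sum_weight_le_one [Fintype E] {q : E → E → ℝ} (hq : ∀ k l, 0 ≤ q k l)
    (hs : ∀ k, ∑ l, q k l ≤ 1) (n : ℕ) (k : E) :
    ∑ p : PathTail E n, weight q k p ≤ 1 := by
  induction n generalizing k with
  | zero => simp [sum_zero]
  | succ n ih =>
    rw [sum_succ]
    simp only [weight_cons, ← Finset.mul_sum]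
    exact (Finset.sum_le_sum fun l _ => mul_le_of_le_one_right (hq k l) (ih l)).trans (hs k)

theorem sum_weight_eq_one [Fintype E] {q : E → E → ℝ}
    (hs : ∀ k, ∑ l, q k l = 1) (n : ℕ) (k : E) :
    ∑ p : PathTail E n, weight q k p = 1 := by
  induction n generalizing k with
  | zero => simp [sum_zero]
  | succ n ih =>
    rw [sum_succ]
    simp [← Finset.mul_sum, ih, hs]

/-- The mean of an additive functional under a stationary Markov chain. -/
theorem sum_weight_mul_total [Fintype E] {q : E → E → ℝ} {μ : E → ℝ}
    (hs : ∀ k, ∑ l, q k l = 1) (hμ : ∀ l, ∑ k, μ k * q k l = μ l) (f : E → E → ℝ) (n : ℕ) :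
    ∑ k, ∑ p : PathTail E n, μ k * weight q k p * total f k p
      = n * ∑ k, ∑ l, μ k * q k l * f k l := by
  induction n with
  | zero => simp [sum_zero]
  | succ n ih =>
    have h1 : ∀ k, ∑ p : PathTail E (n + 1), μ k * weight q k p * total f k p
        = ∑ l, μ k * q k l * f k l
          + ∑ l, μ k * q k l * ∑ p : PathTail E n, weight q l p * total f l p := by
      intro k
      rw [sum_succ, ← Finset.sum_add_distrib]
      refine Finset.sum_congr rfl fun l _ => ?_
      have h2 : μ k * q k l * f k l
          = ∑ p : PathTail E n, μ k * q k l * f k l * weight q l p := by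
        rw [← Finset.mul_sum, sum_weight_eq_one hs, mul_one]
      rw [h2, Finset.mul_sum, ← Finset.sum_add_distrib]
      refine Finset.sum_congr rfl fun p _ => ?_
      simp only [weight_cons, total_cons]
      ring
    simp only [h1, Finset.sum_add_distrib]
    -- Summing over the first point turns `μ k * q k l` into `μ l`, so the remaining `n` steps again
    -- form a stationary path.
    rw [Finset.sum_comm (f := fun k l => μ k * q k l * ∑ p : PathTail E n,
      weight q l p * total f l p)]
    simp only [← Finset.sum_mul, hμ]
    simp only [mul_assoc, Finset.mul_sum] at ih ⊢
    rw [ih]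
    push_cast
    simp only [add_mul, one_mul, Finset.sum_add_distrib]
    ring

theorem abs_total_le {f : E → E → ℤ} {R : ℕ} (hf : ∀ k l, |f k l| ≤ R) {n : ℕ} (k : E)
    (p : PathTail E n) : |total f k p| ≤ n * R := by
  induction p generalizing k with
  | nil => simp
  | cons j p ih =>
    have h1 := hf k j
    have h2 := ih j
    have h3 := abs_add_le (f k j) (total f j p)
    simp only [total_cons]
    push_cast
    linarith

end PathTail

open PathTail

/-! ### Accessibility through positive entries -/

section Accessible
variable {E : Type} [Fintype E] [DecidableEq E] (T : E → E → ℕ)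

/-- `l` is accessible from `k` through positive entries of `T`. -/
def Accessible (k l : E) : Prop := k = l ∨ ∃ n : ℕ, 0 < (Matrix.of T ^ n) k l

variable {T}

theorem Accessible.refl (k : E) : Accessible T k k := Or.inl rfl

theorem Accessible.trans {k l j : E} (h1 : Accessible T k l) (h2 : Accessible T l j) :
    Accessible T k j := by
  rcases h1 with rfl | ⟨n, hn⟩
  · exact h2
  rcases h2 with rfl | ⟨m, hm⟩
  · exact Or.inr ⟨n, hn⟩
  refine Or.inr ⟨n + m, ?_⟩
  rw [pow_add, Matrix.mul_apply]
  exact (Nat.mul_pos hn hm).trans_le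
    (Finset.single_le_sum (f := fun x => (Matrix.of T ^ n) k x * (Matrix.of T ^ m) x j) (fun _ _ => Nat.zero_le _)
      (Finset.mem_univ l))

theorem Accessible.of_ne_zero {k l : E} (h : T k l ≠ 0) : Accessible T k l :=
  Or.inr ⟨1, by rw [pow_one]; exact Nat.pos_of_ne_zero h⟩

end Accessible

/-! ### Weights of walks with given ends and displacement -/

section Walks
variable {E : Type} [Fintype E] [DecidableEq E] (T : E → E → ℕ) (D : E → ℤ)

/-- The displacement of a path: the sum of `D` over all its points but the last. -/
def pathDisp {n : ℕ} (k : E) (p : PathTail E n) : ℤ := total (fun i _ => D i) k p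

/-- The total weight of the paths of `n` steps from `k` to `l` with displacement `s`. -/
def walkWeight (n : ℕ) (k l : E) (s : ℤ) : ℕ :=
  ∑ p : PathTail E n, if last k p = l ∧ pathDisp D k p = s then weight T k p else 0

variable {T D}

theorem walkWeight_zero (k : E) : walkWeight T D 0 k k 0 = 1 := by
  simp [walkWeight, PathTail.sum_zero, pathDisp]

theorem walkWeight_succ (n : ℕ) (k l : E) (s : ℤ) :
    walkWeight T D (n + 1) k l s = ∑ j, T k j * walkWeight T D n j l (s - D k) := by
  simp only [walkWeight, PathTail.sum_succ, Finset.mul_sum]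
  refine Finset.sum_congr rfl fun j _ => Finset.sum_congr rfl fun p _ => ?_
  simp only [last_cons, weight_cons, pathDisp, total_cons, mul_ite, mul_zero, eq_sub_iff_add_eq']
  congr

/-- Concatenation of walks. Displacements add because the last point is not counted; equality fails
because only walks through `l` at time `n` are produced. -/
theorem walkWeight_mul_le (n m : ℕ) (k l j : E) (s s' : ℤ) :
    walkWeight T D n k l s * walkWeight T D m l j s' ≤ walkWeight T D (n + m) k j (s + s') := by
  induction n generalizing k s with
  | zero =>
    by_cases h : k = l ∧ 0 = s
    · obtain ⟨rfl, rfl⟩ := h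
      simp [walkWeight_zero]
    · have : walkWeight T D 0 k l s = 0 := by
        simp [walkWeight, PathTail.sum_zero, pathDisp, h]
      simp [this]
  | succ n ih =>
    rw [Nat.add_right_comm, walkWeight_succ, walkWeight_succ, Finset.sum_mul]
    refine Finset.sum_le_sum fun i _ => ?_
    rw [mul_assoc]
    refine Nat.mul_le_mul_left _ ((ih i (s - D k)).trans_eq ?_)
    congr 1
    ring

theorem abs_le_of_walkWeight_ne_zero {R : ℕ} (hD : ∀ k, |D k| ≤ R) {n : ℕ} {k l : E} {s : ℤ}
    (h : walkWeight T D n k l s ≠ 0) : |s| ≤ n * R := by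
  obtain ⟨p, -, hp⟩ := Finset.exists_ne_zero_of_sum_ne_zero h
  obtain ⟨-, rfl⟩ := (ite_ne_right_iff.1 hp).1
  exact abs_total_le (fun k _ => hD k) k p

theorem exists_walkWeight_of_accessible {k l : E} (h : Accessible T k l) :
    ∃ n s, 1 ≤ walkWeight T D n k l s := by
  rcases h with rfl | ⟨n, hn⟩
  · exact ⟨0, 0, walkWeight_zero k |>.ge⟩
  induction n generalizing k with
  | zero =>
    have : k = l := by
      by_contra hne
      simp [hne] at hn
    subst this
    exact ⟨0, 0, walkWeight_zero k |>.ge⟩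
  | succ n ih =>
    rw [pow_succ', Matrix.mul_apply] at hn
    obtain ⟨j, -, hj⟩ := Finset.exists_ne_zero_of_sum_ne_zero hn.ne'
    obtain ⟨m, s, hm⟩ := ih (Nat.pos_of_ne_zero (right_ne_zero_of_mul hj))
    refine ⟨m + 1, s + D k, ?_⟩
    rw [walkWeight_succ]
    refine le_trans ?_ (Finset.single_le_sum (fun _ _ => Nat.zero_le _) (Finset.mem_univ j))
    rw [add_sub_cancel_right]
    exact Nat.mul_pos (Nat.pos_of_ne_zero (left_ne_zero_of_mul hj)) hm

theorem weight_le_walkWeight {n : ℕ} (k : E) (p : PathTail E n) :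
    weight T k p ≤ walkWeight T D n k (last k p) (pathDisp D k p) := by
  refine le_trans ?_ (Finset.single_le_sum (fun _ _ => Nat.zero_le _) (Finset.mem_univ p))
  simp

theorem walkWeight_pow_le {n : ℕ} {k : E} {s : ℤ} (m : ℕ) :
    walkWeight T D n k k s ^ m ≤ walkWeight T D (m * n) k k (m * s) := by
  induction m with
  | zero => simp [walkWeight_zero]
  | succ m ih =>
    rw [pow_succ]
    refine (Nat.mul_le_mul_right _ ih).trans ((walkWeight_mul_le _ _ _ _ _ _ _).trans_eq ?_)
    congr 1
    · ring
    · push_cast; ring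

/-- Loops at base points that are accessible in the order of a list are run through one after the
other. -/
theorem exists_walkWeight_loops {ι : Type} {base : ι → E} {len : ι → ℕ} {s : ι → ℤ} {w : ι → ℕ}
    (hw : ∀ i, w i ≤ walkWeight T D (len i) (base i) (base i) (s i)) {Q : E → Prop}
    (hQ : ∀ i, Q (base i)) (L : List ι) (b : E) (hb : Q b)
    (hL : List.IsChain (Accessible T) (b :: L.map base)) :
    ∃ (c : ℕ) (d : ℤ) (l : E), Q l ∧ ∀ m : ι → ℕ,
      (L.map fun i => w i ^ m i).prod ≤
        walkWeight T D ((L.map fun i => m i * len i).sum + c) b l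
          ((L.map fun i => m i * s i).sum + d) := by
  induction L generalizing b with
  | nil => exact ⟨0, 0, b, hb, fun m => by simp [walkWeight_zero]⟩
  | cons i L ih =>
    rw [List.map_cons, List.isChain_cons_cons] at hL
    obtain ⟨c, d, l, hl, h⟩ := ih (base i) (hQ i) hL.2
    obtain ⟨c₁, d₁, h₁⟩ := exists_walkWeight_of_accessible (D := D) hL.1
    -- The connecting walk is used once whatever the multiplicities, so its length and displacement
    -- do not depend on `m`.
    refine ⟨c₁ + c, d₁ + d, l, hl, fun m => ?_⟩
    have h₂ : w i ^ m i ≤ walkWeight T D (m i * len i) (base i) (base i) (m i * s i) :=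
      (Nat.pow_le_pow_left (hw i) _).trans (walkWeight_pow_le _)
    have h₃ := (Nat.mul_le_mul h₂ (h m)).trans (walkWeight_mul_le _ _ _ _ _ _ _)
    have h₄ := (Nat.mul_le_mul h₁ h₃).trans (walkWeight_mul_le _ _ _ _ _ _ _)
    rw [one_mul] at h₄
    simp only [List.map_cons, List.prod_cons, List.sum_cons]
    refine h₄.trans_eq ?_
    congr 1 <;> ring

end Walks

/-! ### Stationary chains and the entropy of `n` steps -/

section Stationary
variable {E : Type} [Fintype E] [DecidableEq E]

/-- A stationary Markov chain `(μ, q)` whose steps have positive weight in `T`. -/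
structure IsStationaryOn (T : E → E → ℕ) (μ : E → ℝ) (q : E → E → ℝ) : Prop where
  kernel_nonneg : ∀ k l, 0 ≤ q k l
  kernel_sum : ∀ k, ∑ l, q k l = 1
  nonneg : ∀ k, 0 ≤ μ k
  sum_eq_one : ∑ k, μ k = 1
  invariant : ∀ l, ∑ k, μ k * q k l = μ l
  positive : ∀ k l, μ k * q k l ≠ 0 → T k l ≠ 0

namespace IsStationaryOn
variable {T : E → E → ℕ} {D : E → ℤ} {μ : E → ℝ} {q : E → E → ℝ} (h : IsStationaryOn T μ q)
include h

theorem pos_of_step {k l : E} (hk : 0 < μ k) (hkl : 0 < q k l) : 0 < μ l := by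
  rw [← h.invariant l]
  exact (mul_pos hk hkl).trans_le (Finset.single_le_sum (f := fun k => μ k * q k l)
    (fun i _ => mul_nonneg (h.nonneg i) (h.kernel_nonneg i l)) (Finset.mem_univ k))

/-- The steps of a stationary chain can be undone. -/
theorem accessible_of_step {k l : E} (hk : 0 < μ k) (hkl : 0 < q k l) : Accessible T l k := by
  classical
  by_contra hcon
  -- The chain cannot leave `A`, so by invariance no mass flows into `A` from its complement. If `k`
  -- were outside `A`, the step from `k` to `l` would be such a flow.
  let A : Finset E := Finset.univ.filter fun j => Accessible T l j
  have hclosed : ∀ i ∈ A, μ i * ∑ j ∈ A, q i j = μ i := by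
    intro i hi
    by_cases hi0 : μ i = 0
    · simp [hi0]
    have : ∑ j ∈ A, q i j = 1 := by
      rw [← h.kernel_sum i]
      refine Finset.sum_subset (Finset.subset_univ _) fun j _ hj => ?_
      by_contra hq
      refine hj (Finset.mem_filter.2 ⟨Finset.mem_univ _, ?_⟩)
      exact (Finset.mem_filter.1 hi).2.trans
        (Accessible.of_ne_zero (h.positive i j (mul_ne_zero hi0 hq)))
    rw [this, mul_one]
  have h1 : ∑ j ∈ A, μ j = ∑ i, μ i * ∑ j ∈ A, q i j := by
    simp only [Finset.mul_sum]
    rw [Finset.sum_comm]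
    exact Finset.sum_congr rfl fun j _ => (h.invariant j).symm
  rw [← Finset.sum_add_sum_compl A, Finset.sum_congr rfl hclosed, left_eq_add] at h1
  have hnn : ∀ i, 0 ≤ μ i * ∑ j ∈ A, q i j := fun i =>
    mul_nonneg (h.nonneg i) (Finset.sum_nonneg fun j _ => h.kernel_nonneg i j)
  have h2 := (Finset.sum_eq_zero_iff_of_nonneg fun i _ => hnn i).1 h1 k
    (Finset.mem_compl.2 fun hkA => hcon (Finset.mem_filter.1 hkA).2)
  have hlA : l ∈ A := Finset.mem_filter.2 ⟨Finset.mem_univ _, Accessible.refl l⟩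
  have h3 : 0 < ∑ j ∈ A, q k j := hkl.trans_le
    (Finset.single_le_sum (fun j _ => h.kernel_nonneg k j) hlA)
  exact (mul_pos hk h3).ne' h2

/-- Multiplicativity turns the sum of logarithms into the logarithm of a ratio of path weights;
undoing the steps one by one leads back from the last point to the first. -/
theorem path_spec {n : ℕ} {k : E} {p : PathTail E n} (hk : 0 < μ k) (hp : 0 < weight q k p) :
    0 < weight T k p ∧
      total (fun i j => Real.log (T i j / q i j)) k p
        = Real.log (weight T k p : ℕ) - Real.log (weight q k p) ∧
      0 < μ (last k p) ∧ Accessible T (last k p) k := by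
  induction p generalizing k with
  | nil => simp [hk, Accessible.refl]
  | cons j p ih =>
    rw [weight_cons] at hp
    have hkj : 0 < q k j := (h.kernel_nonneg k j).lt_of_ne fun h0 => by simp [← h0] at hp
    have hp' : 0 < weight q j p := pos_of_mul_pos_right hp hkj.le
    have hT : T k j ≠ 0 := h.positive k j (mul_pos hk hkj).ne'
    obtain ⟨h1, h2, h3, h4⟩ := ih (h.pos_of_step hk hkj) hp'
    refine ⟨Nat.mul_pos (Nat.pos_of_ne_zero hT) h1, ?_, h3,
      h4.trans (h.accessible_of_step hk hkj)⟩
    have hT' : (T k j : ℝ) ≠ 0 := Nat.cast_ne_zero.2 hT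
    have hw : ((weight T j p : ℕ) : ℝ) ≠ 0 := Nat.cast_ne_zero.2 h1.ne'
    simp only [total_cons, weight_cons, h2, Nat.cast_mul]
    rw [Real.log_div hT' hkj.ne', Real.log_mul hT' hw, Real.log_mul hkj.ne' hp'.ne']
    ring

theorem sum_pathMass (n : ℕ) : ∑ k, ∑ p : PathTail E n, μ k * weight q k p = 1 := by
  simp only [← Finset.mul_sum, sum_weight_eq_one h.kernel_sum, mul_one, h.sum_eq_one]

theorem pathMass_nonneg {n : ℕ} (k : E) (p : PathTail E n) : 0 ≤ μ k * weight q k p :=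
  mul_nonneg (h.nonneg k) (weight_nonneg h.kernel_nonneg k p)

theorem le_one (k : E) : μ k ≤ 1 := by
  rw [← h.sum_eq_one]
  exact Finset.single_le_sum (fun i _ => h.nonneg i) (Finset.mem_univ k)

theorem sum_pathMass_mul_disp (n : ℕ) :
    ∑ k, ∑ p : PathTail E n, μ k * weight q k p * (pathDisp D k p : ℝ)
      = n * ∑ k, μ k * D k := by
  have h1 := sum_weight_mul_total h.kernel_sum h.invariant (fun i _ => (D i : ℝ)) n
  have h2 : ∀ (k : E) (p : PathTail E n),
      total (fun i _ => (D i : ℝ)) k p = (pathDisp D k p : ℝ) := by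
    intro k p
    unfold pathDisp
    clear h1
    induction p generalizing k with
    | nil => simp
    | cons j p ih => simp [ih]
  simp only [h2] at h1
  rw [h1]
  congr 1
  refine Finset.sum_congr rfl fun k _ => ?_
  rw [← Finset.sum_mul, ← Finset.mul_sum, h.kernel_sum, mul_one]

end IsStationaryOn

/-- Group the paths by start, end and displacement. Within a class the weights add up to the
denominator, so a class contributes at most one, and the right-hand side bounds the number of
classes. -/
theorem sum_weight_div_walkWeight_le {T : E → E → ℕ} {D : E → ℤ} {R : ℕ} (hD : ∀ k, |D k| ≤ R)
    (n : ℕ) :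
    ∑ k, ∑ p : PathTail E n, ((weight T k p : ℕ) : ℝ)
        / (walkWeight T D n k (last k p) (pathDisp D k p) : ℝ)
      ≤ (Fintype.card E : ℝ) ^ 2 * (2 * (n * R) + 1) := by
  have hk : ∀ k, ∑ p : PathTail E n, ((weight T k p : ℕ) : ℝ)
        / (walkWeight T D n k (last k p) (pathDisp D k p) : ℝ)
      ≤ (Fintype.card E : ℝ) * (2 * (n * R) + 1) := by
    intro k
    let S : Finset (E × ℤ) := Finset.univ ×ˢ Finset.Icc (-(n * R : ℤ)) (n * R)
    have hS : ((S.card : ℕ) : ℝ) = (Fintype.card E : ℝ) * (2 * (n * R) + 1) := by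
      have : ((n * R + 1 - -(n * R : ℤ)).toNat : ℤ) = 2 * (n * R) + 1 := by
        have h0 : (0 : ℤ) ≤ n * R := by positivity
        rw [Int.toNat_of_nonneg (by linarith)]
        ring
      rw [Finset.card_product, Int.card_Icc, Finset.card_univ]
      push_cast
      congr 1
      exact_mod_cast this
    rw [← Finset.sum_fiberwise_of_maps_to (s := Finset.univ) (t := S)
      (g := fun p : PathTail E n => (last k p, pathDisp D k p)), ← hS, ← nsmul_one,
      ← Finset.sum_const]
    · refine Finset.sum_le_sum fun x _ => ?_
      have h1 : ∑ p : PathTail E n with (last k p, pathDisp D k p) = x,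
          ((weight T k p : ℕ) : ℝ) / (walkWeight T D n k (last k p) (pathDisp D k p) : ℝ)
          = (walkWeight T D n k x.1 x.2 : ℝ) / (walkWeight T D n k x.1 x.2 : ℝ) := by
        conv_rhs => enter [1]; rw [walkWeight]
        rw [Nat.cast_sum, Finset.sum_div, Finset.sum_filter]
        refine Finset.sum_congr rfl fun p _ => ?_
        by_cases hx : (last k p, pathDisp D k p) = x
        · subst hx
          simp
        · have : ¬ (last k p = x.1 ∧ pathDisp D k p = x.2) := fun hh => hx (Prod.ext hh.1 hh.2)
          simp [hx, this]
      rw [h1]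
      -- A class of weight zero contributes `0 / 0 = 0`.
      exact div_self_le_one _
    · intro p _
      refine Finset.mem_product.2 ⟨Finset.mem_univ _, Finset.mem_Icc.2 (abs_le.1 ?_)⟩
      exact abs_total_le (fun k _ => hD k) k p
  calc _ ≤ ∑ _k : E, (Fintype.card E : ℝ) * (2 * (n * R) + 1) := Finset.sum_le_sum fun k _ => hk k
    _ = _ := by simp; ring

/-- The entropy of `n` steps is at most the mean logarithm of the total weight of the paths with the
same ends and the same displacement, up to the logarithm of the number of these classes. -/
theorem IsStationaryOn.entropy_le {T : E → E → ℕ} {D : E → ℤ} {μ : E → ℝ} {q : E → E → ℝ}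
    (h : IsStationaryOn T μ q) {R : ℕ} (hD : ∀ k, |D k| ≤ R) [Nonempty E] (n : ℕ) :
    n * ∑ k, ∑ l, μ k * q k l * Real.log (T k l / q k l)
      ≤ ∑ k, ∑ p : PathTail E n, μ k * weight q k p *
          Real.log (walkWeight T D n k (last k p) (pathDisp D k p))
        + Real.log ((Fintype.card E : ℝ) ^ 2 * (2 * (n * R) + 1)) := by
  set c : ℝ := (Fintype.card E : ℝ) ^ 2 * (2 * (n * R) + 1) with hc
  have hc0 : 0 < c := by
    have : (0 : ℝ) < Fintype.card E := Nat.cast_pos.2 Fintype.card_pos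
    positivity
  rw [← sum_weight_mul_total h.kernel_sum h.invariant]
  -- Gibbs' inequality in pointwise form: the path law `P` is compared with the measure `w / (W c)`,
  -- whose total mass is at most one by the choice of `c`.
  have hterm : ∀ (k : E) (p : PathTail E n),
      μ k * weight q k p * total (fun i j => Real.log (T i j / q i j)) k p
      ≤ μ k * weight q k p * Real.log (walkWeight T D n k (last k p) (pathDisp D k p))
        + μ k * weight q k p * (Real.log c - 1)
        + ((weight T k p : ℕ) : ℝ)
          / (walkWeight T D n k (last k p) (pathDisp D k p) : ℝ) / c := by
    intro k p
    rcases (h.pathMass_nonneg k p).eq_or_lt with h0 | hP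
    · rw [← h0]
      simp only [zero_mul, zero_add]
      positivity
    have hμk : 0 < μ k := (h.nonneg k).lt_of_ne fun h0 => by simp [← h0] at hP
    have hq : 0 < weight q k p := pos_of_mul_pos_right hP hμk.le
    obtain ⟨hw, hlog, -, -⟩ := h.path_spec hμk hq
    rw [hlog]
    set P := μ k * weight q k p
    set w : ℝ := ((weight T k p : ℕ) : ℝ)
    set W : ℝ := (walkWeight T D n k (last k p) (pathDisp D k p) : ℝ)
    have hw0 : 0 < w := Nat.cast_pos.2 hw
    have hW : 0 < W := hw0.trans_le (Nat.cast_le.2 (weight_le_walkWeight k p))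
    -- As `μ k ≤ 1`, replacing the conditional path probability by `P` only enlarges the left-hand
    -- side.
    have hPq : Real.log P ≤ Real.log (weight q k p) :=
      Real.log_le_log hP (mul_le_of_le_one_left hq.le (h.le_one k))
    have hj := Real.log_le_sub_one_of_pos (div_pos (div_pos hw0 hW) (mul_pos hP hc0))
    rw [Real.log_div (div_pos hw0 hW).ne' (mul_pos hP hc0).ne', Real.log_div hw0.ne' hW.ne',
      Real.log_mul hP.ne' hc0.ne'] at hj
    have h1 : Real.log w - Real.log (weight q k p)
        ≤ Real.log W + (Real.log c - 1) + w / W / (P * c) := by linarith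
    calc P * (Real.log w - Real.log (weight q k p))
        ≤ P * (Real.log W + (Real.log c - 1) + w / W / (P * c)) :=
          mul_le_mul_of_nonneg_left h1 hP.le
      _ = _ := by field_simp
  have h2 := sum_weight_div_walkWeight_le (T := T) hD n
  rw [← hc] at h2
  refine (Finset.sum_le_sum fun k _ => Finset.sum_le_sum fun p _ => hterm k p).trans ?_
  simp only [Finset.sum_add_distrib, ← Finset.sum_mul, ← Finset.sum_div, h.sum_pathMass]
  have h3 := (div_le_one hc0).2 h2
  linarith

end Stationary

/-! ### Lower bound: long walks assembled from loops -/

section Loops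
variable {E : Type} [Fintype E] [DecidableEq E] {T : E → E → ℕ} {D : E → ℤ}

/-- A stationary chain never stops, which allows a walk ending at a charged point to be padded to
any length. -/
theorem IsStationaryOn.exists_walk {μ : E → ℝ} {q : E → E → ℝ} (h : IsStationaryOn T μ q)
    {l : E} (hl : 0 < μ l) (r : ℕ) : ∃ l' s, 1 ≤ walkWeight T D r l l' s := by
  induction r generalizing l with
  | zero => exact ⟨l, 0, (walkWeight_zero l).ge⟩
  | succ r ih =>
    obtain ⟨j, -, hj⟩ : ∃ j ∈ Finset.univ, q l j ≠ 0 :=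
      Finset.exists_ne_zero_of_sum_ne_zero (by rw [h.kernel_sum l]; exact one_ne_zero)
    obtain ⟨l', s, hs⟩ := ih (h.pos_of_step hl ((h.kernel_nonneg l j).lt_of_ne' hj))
    refine ⟨l', s + D l, ?_⟩
    rw [walkWeight_succ]
    refine le_trans ?_ (Finset.single_le_sum (fun _ _ => Nat.zero_le _) (Finset.mem_univ j))
    rw [add_sub_cancel_right]
    exact Nat.mul_pos (Nat.pos_of_ne_zero (h.positive l j (mul_ne_zero hl.ne' hj))) hs

/-- Finitely many loops at pairwise comparable base points can be run through in one walk. -/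
theorem exists_walkWeight_prod {ι : Type} [Fintype ι] [Nonempty ι] {base : ι → E} {len : ι → ℕ}
    {s : ι → ℤ} {w : ι → ℕ} (hw : ∀ i, w i ≤ walkWeight T D (len i) (base i) (base i) (s i))
    {Q : E → Prop} (hQ : ∀ i, Q (base i))
    (hcomp : ∀ i j, Accessible T (base i) (base j) ∨ Accessible T (base j) (base i))
    (b : E) (hb : ∀ i, Accessible T b (base i)) :
    ∃ (c : ℕ) (d : ℤ) (l : E), Q l ∧ ∀ m : ι → ℕ,
      ∏ i, w i ^ m i ≤
        walkWeight T D (∑ i, m i * len i + c) b l (∑ i, m i * s i + d) := by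
  classical
  -- Accessibility of base points is a total preorder on the loops, so they can be sorted along it.
  let r : ι → ι → Prop := fun i j => Accessible T (base i) (base j)
  have : Std.Total r := ⟨hcomp⟩
  have : IsTrans ι r := ⟨fun _ _ _ => Accessible.trans⟩
  have hperm := List.perm_insertionSort r (Finset.univ : Finset ι).toList
  have hsort := List.pairwise_insertionSort r (Finset.univ : Finset ι).toList
  set L := List.insertionSort r (Finset.univ : Finset ι).toList with hL
  rcases hLc : L with _ | ⟨i, L'⟩
  · rw [hLc] at hperm
    have := hperm.nil_eq
    exact absurd (by simpa using this) Finset.univ_nonempty.ne_empty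
  have hchain : List.IsChain (Accessible T) (base i :: L.map base) := by
    refine List.Pairwise.isChain (List.pairwise_cons.2 ⟨?_, List.pairwise_map.2 hsort⟩)
    intro j hj
    obtain ⟨i', hi', rfl⟩ := List.mem_map.1 hj
    rw [hLc] at hi' hsort
    rcases List.mem_cons.1 hi' with rfl | hi''
    · exact Accessible.refl _
    · exact (List.pairwise_cons.1 hsort).1 _ hi''
  -- The chain starts at the first base point rather than at `b`, which need not satisfy `Q`.
  obtain ⟨c, d, l, hl, hm⟩ := exists_walkWeight_loops hw hQ L (base i) (hQ i) hchain
  obtain ⟨c₁, d₁, h₁⟩ := exists_walkWeight_of_accessible (D := D) (hb i)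
  refine ⟨c₁ + c, d₁ + d, l, hl, fun m => ?_⟩
  have h₂ := (Nat.mul_le_mul h₁ (hm m)).trans (walkWeight_mul_le _ _ _ _ _ _ _)
  rw [one_mul, (hperm.map _).prod_eq, (hperm.map _).sum_eq, (hperm.map _).sum_eq,
    Finset.prod_map_toList, Finset.sum_map_toList, Finset.sum_map_toList] at h₂
  refine h₂.trans_eq ?_
  congr 1 <;> ring

/-- Loops run through with given frequencies, padded to any large length. -/
theorem exists_walkWeight_frequencies {ι : Type} [Fintype ι] {len : ι → ℕ}
    {s : ι → ℤ} {w : ι → ℕ} (hw : ∀ i, 1 ≤ w i) {R : ℕ} (hD : ∀ k, |D k| ≤ R) {b l : E}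
    {c₀ : ℕ} {d₀ : ℤ}
    (hwalk : ∀ m : ι → ℕ, ∏ i, w i ^ m i ≤
        walkWeight T D (∑ i, m i * len i + c₀) b l (∑ i, m i * s i + d₀))
    (hl : ∀ r, ∃ l' s, 1 ≤ walkWeight T D r l l' s)
    {n c : ℕ} (hn : 1 ≤ n) (hlen : ∀ i, n ≤ len i) (hlen' : ∀ i, len i ≤ n + c)
    {P : ι → ℝ} (hP : ∀ i, 0 ≤ P i) (hP1 : ∑ i, P i = 1) {x : ι → ℝ} {a : ℝ}
    (hx : ∑ i, P i * x i = n * a) (hs : ∀ i, |s i - x i| ≤ c * R) :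
    ∃ K : ℝ, ∀ N : ℕ, c₀ ≤ N → ∃ (l' : E) (s' : ℤ), |(s' : ℝ) - N * a| ≤ K + N * (c * (2 * R + |a|) / n) ∧
      Real.exp (N * ((∑ i, P i * Real.log (w i)) / (n + c)) - K) ≤ walkWeight T D N b l' s' := by
  set hbar := ∑ i, P i * Real.log (w i) with hhbar
  have hlog : ∀ i, 0 ≤ Real.log (w i) := fun i => Real.log_nonneg (by exact_mod_cast hw i)
  have hbar0 : 0 ≤ hbar := Finset.sum_nonneg fun i _ => mul_nonneg (hP i) (hlog i)
  set k₁ : ℝ := n + c + c₀ with hk₁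
  have hn0 : (0 : ℝ) < n := by exact_mod_cast hn
  have hnc : (0 : ℝ) < n + c := by positivity
  set K₁ : ℝ := ∑ i, |(s i : ℝ)| + |(d₀ : ℝ)| + R * (k₁ + Fintype.card ι * n) + |a| * k₁ with hK₁
  set K₂ : ℝ := k₁ / (n + c) * hbar + ∑ i, Real.log (w i) with hK₂
  refine ⟨max K₁ K₂, fun N hN => ?_⟩
  -- The number of rounds that fit: on average a round has at most `n + c` steps, and less than `k₁`
  -- steps are left over.
  set M : ℕ := (N - c₀) / (n + c) with hM
  have hMle : (M : ℝ) * (n + c) + c₀ ≤ N := by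
    have := Nat.div_mul_le_self (N - c₀) (n + c)
    rw [← hM] at this
    exact_mod_cast (by omega : M * (n + c) + c₀ ≤ N)
  have hMlt : (N : ℝ) ≤ M * (n + c) + k₁ := by
    have := Nat.lt_div_mul_add (a := N - c₀) (b := n + c) (by omega)
    rw [← hM] at this
    have h2 : N ≤ M * (n + c) + (n + c + c₀) := by omega
    rw [hk₁]
    exact_mod_cast h2
  -- Rounding down loses at most one run of each loop, a cost independent of `N`.
  let m : ι → ℕ := fun i => ⌊P i * M⌋₊
  have hm1 : ∀ i, (m i : ℝ) ≤ P i * M := fun i => Nat.floor_le (by have := hP i; positivity)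
  have hm2 : ∀ i, P i * M - 1 ≤ (m i : ℝ) := fun i => (Nat.sub_one_lt_floor _).le
  have hPM : ∑ i, P i * (M : ℝ) = M := by rw [← Finset.sum_mul, hP1, one_mul]
  set ℓ : ℕ := ∑ i, m i * len i + c₀ with hℓ
  have hℓcast : (ℓ : ℝ) = ∑ i, (m i : ℝ) * len i + c₀ := by rw [hℓ]; push_cast; rfl
  have hℓle : ℓ ≤ N := by
    have : (ℓ : ℝ) ≤ N := by
      refine le_trans ?_ hMle
      rw [hℓcast]
      gcongr
      calc ∑ i, (m i : ℝ) * len i ≤ ∑ i, P i * M * (n + c) := by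
            refine Finset.sum_le_sum fun i _ => ?_
            have h3 : (len i : ℝ) ≤ n + c := by exact_mod_cast hlen' i
            have h4 := hP i
            exact mul_le_mul (hm1 i) h3 (by positivity) (by positivity)
        _ = _ := by rw [← Finset.sum_mul, hPM]
    exact_mod_cast this
  have hℓge : (M : ℝ) * n - Fintype.card ι * n ≤ ℓ := by
    rw [hℓcast]
    have : ∑ i, (P i * M - 1) * (n : ℝ) ≤ ∑ i, (m i : ℝ) * len i := by
      refine Finset.sum_le_sum fun i _ => ?_
      have h3 : (n : ℝ) ≤ len i := by exact_mod_cast hlen i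
      exact (mul_le_mul_of_nonneg_right (hm2 i) hn0.le).trans
        (mul_le_mul_of_nonneg_left h3 (by positivity))
    rw [← Finset.sum_mul, Finset.sum_sub_distrib, hPM] at this
    simp only [Finset.sum_const, Finset.card_univ, nsmul_eq_mul, mul_one] at this
    have h5 : (0 : ℝ) ≤ c₀ := by positivity
    linarith
  -- Padding by an arbitrary walk reaches length exactly `N`; its displacement is at most `R` per
  -- step.
  obtain ⟨l', sp, hsp⟩ := hl (N - ℓ)
  have hspR := abs_le_of_walkWeight_ne_zero hD (Nat.one_le_iff_ne_zero.1 hsp)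
  refine ⟨l', ∑ i, m i * s i + d₀ + sp, ?_, ?_⟩
  · have hspR' : |(sp : ℝ)| ≤ (N - ℓ) * R := by
      have : ((|sp| : ℤ) : ℝ) ≤ (((N - ℓ : ℕ) : ℤ) * (R : ℤ) : ℤ) := by exact_mod_cast hspR
      rw [Int.cast_abs] at this
      push_cast [Nat.cast_sub hℓle] at this
      exact this
    have hS : |∑ i, (m i : ℝ) * s i - M * (n * a)| ≤ ∑ i, |(s i : ℝ)| + M * (c * R) := by
      have e1 : ∑ i, (m i : ℝ) * s i - M * (n * a)
          = ∑ i, ((m i - P i * M) * s i + P i * M * (s i - x i)) := by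
        rw [← hx, Finset.mul_sum, ← Finset.sum_sub_distrib]
        exact Finset.sum_congr rfl fun i _ => by ring
      have e2 : (M : ℝ) * (c * R) = ∑ i, P i * M * (c * R) := by
        rw [← Finset.sum_mul, hPM]
      rw [e1, e2, ← Finset.sum_add_distrib]
      refine (Finset.abs_sum_le_sum_abs _ _).trans (Finset.sum_le_sum fun i _ => ?_)
      refine (abs_add_le _ _).trans (add_le_add ?_ ?_)
      · rw [abs_mul]
        refine mul_le_of_le_one_left (abs_nonneg _) (abs_le.2 ⟨?_, ?_⟩)
        · linarith [hm2 i]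
        · linarith [hm1 i]
      · have h4 := hP i
        rw [abs_mul, abs_of_nonneg (by positivity)]
        exact mul_le_mul_of_nonneg_left (hs i) (by positivity)
    push_cast
    have e3 : ∑ i, (m i : ℝ) * s i + d₀ + sp - N * a
        = (∑ i, (m i : ℝ) * s i - M * (n * a)) + d₀ + sp + -((N - M * n) * a) := by ring
    have hNM : (0 : ℝ) ≤ N - M * n := by
      have : (0 : ℝ) ≤ M * c + c₀ := by positivity
      linarith
    have hNM' : (N : ℝ) - M * n ≤ M * c + k₁ := by linarith
    have hr : ((N : ℝ) - ℓ) * R ≤ (M * c + k₁ + Fintype.card ι * n) * R :=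
      mul_le_mul_of_nonneg_right (by linarith) (by positivity)
    have ha : |(-((N - M * n) * a) : ℝ)| ≤ (M * c + k₁) * |a| := by
      rw [abs_neg, abs_mul, abs_of_nonneg hNM]
      exact mul_le_mul_of_nonneg_right hNM' (abs_nonneg a)
    -- Per round, the return walks cost `c R`, the padding another `c R`, and the length `n + c`
    -- instead of `n` costs `c |a|`.
    have hMn : (M : ℝ) * (c * (2 * R + |a|)) ≤ N * (c * (2 * R + |a|) / n) := by
      rw [mul_div_assoc', le_div_iff₀ hn0]
      have h6 : (M : ℝ) * n ≤ N := by linarith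
      have h7 : (0 : ℝ) ≤ c * (2 * R + |a|) := by positivity
      nlinarith [mul_le_mul_of_nonneg_right h6 h7]
    rw [e3]
    have t1 := abs_add_le ((∑ i, (m i : ℝ) * s i - M * (n * a)) + d₀ + sp) (-((N - M * n) * a))
    have t2 := abs_add_le ((∑ i, (m i : ℝ) * s i - M * (n * a)) + d₀) sp
    have t3 := abs_add_le (∑ i, (m i : ℝ) * s i - M * (n * a)) d₀
    have t4 := le_max_left K₁ K₂
    rw [hK₁] at t4 ⊢
    linarith
  · have hW : ∏ i, w i ^ m i ≤ walkWeight T D N b l' (∑ i, m i * s i + d₀ + sp) := by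
      have h1 := (Nat.mul_le_mul (hwalk m) hsp).trans (walkWeight_mul_le _ _ _ _ _ _ _)
      rw [mul_one, Nat.add_sub_cancel' hℓle] at h1
      exact h1
    refine le_trans ?_ (Nat.cast_le.2 hW)
    push_cast
    have hwpos : ∀ i, (0 : ℝ) < w i := fun i => by exact_mod_cast hw i
    rw [← Real.exp_log (Finset.prod_pos fun i _ => pow_pos (hwpos i) (m i)),
      Real.log_prod (fun i _ => (pow_pos (hwpos i) (m i)).ne')]
    simp only [Real.log_pow]
    refine Real.exp_le_exp.2 ?_
    have h1 : ∑ i, (P i * M - 1) * Real.log (w i) ≤ ∑ i, (m i : ℝ) * Real.log (w i) :=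
      Finset.sum_le_sum fun i _ => mul_le_mul_of_nonneg_right (hm2 i) (hlog i)
    have h2 : ∑ i, (P i * M - 1) * Real.log (w i) = M * hbar - ∑ i, Real.log (w i) := by
      rw [hhbar, Finset.mul_sum, ← Finset.sum_sub_distrib]
      exact Finset.sum_congr rfl fun i _ => by ring
    have h3 : (N : ℝ) * (hbar / (n + c)) ≤ M * hbar + k₁ / (n + c) * hbar := by
      have : (N : ℝ) * (hbar / (n + c)) = N / (n + c) * hbar := by ring
      rw [this, ← add_mul]
      refine mul_le_mul_of_nonneg_right ?_ hbar0
      rw [div_le_iff₀ hnc, add_mul, div_mul_cancel₀ _ hnc.ne']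
      exact hMlt
    have t4 := le_max_right K₁ K₂
    rw [hK₂] at t4 ⊢
    linarith

theorem eventually_log_lt {A B δ : ℝ} (hA : 0 < A) (hδ : 0 < δ) :
    ∀ᶠ n : ℕ in atTop, Real.log (A * n) + B < n * δ := by
  have h1 := (Real.isLittleO_log_id_atTop.comp_tendsto tendsto_natCast_atTop_atTop).bound
    (half_pos hδ)
  have h2 : ∀ᶠ n : ℕ in atTop, Real.log A + B < n * (δ / 2) :=
    (tendsto_natCast_atTop_atTop.atTop_mul_const (half_pos hδ)).eventually_gt_atTop _
  filter_upwards [h1, h2, eventually_ge_atTop 1] with n hn1 hn2 hn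
  have hn0 : (0 : ℝ) < n := by exact_mod_cast hn
  rw [Real.log_mul hA.ne' hn0.ne']
  have h3 := (le_abs_self _).trans hn1
  simp only [Function.comp, id, Real.norm_eq_abs, abs_of_pos hn0] at h3
  linarith

/-- Walks that realise the entropy and the drift of a stationary chain. -/
theorem IsStationaryOn.eventually_exists_walkWeight {μ : E → ℝ} {q : E → E → ℝ}
    (h : IsStationaryOn T μ q) {b : E} (hb : ∀ k, 0 < μ k → Accessible T b k)
    (hcomp : ∀ k l, 0 < μ k → 0 < μ l → Accessible T k l ∨ Accessible T l k)
    {a : ℝ} (ha : ∑ k, μ k * D k = a) {z : ℝ}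
    (hz : z < ∑ k, ∑ l, μ k * q k l * Real.log (T k l / q k l)) {ε : ℝ} (hε : 0 < ε) :
    ∀ᶠ N : ℕ in atTop, ∃ (l : E) (s : ℤ), |(s : ℝ) - N * a| ≤ ε * N ∧
      Real.exp (N * z) ≤ walkWeight T D N b l s := by
  classical
  have : Nonempty E := ⟨b⟩
  set H := ∑ k, ∑ l, μ k * q k l * Real.log (T k l / q k l)
  let R : ℕ := Finset.univ.sup fun k => (D k).natAbs
  have hR : ∀ k, |D k| ≤ R := fun k => by
    have := Finset.le_sup (f := fun k => (D k).natAbs) (Finset.mem_univ k)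
    rw [Int.abs_eq_natAbs]
    exact_mod_cast this
  -- The length and displacement of a return walk are chosen for all pairs, with dummy values `0`
  -- where no return exists, so that one bound `c` covers all lengths.
  have hex : ∀ l k, ∃ (r : ℕ) (s : ℤ), Accessible T l k → 1 ≤ walkWeight T D r l k s := by
    intro l k
    by_cases hlk : Accessible T l k
    · obtain ⟨r, s, hrs⟩ := exists_walkWeight_of_accessible (D := D) hlk
      exact ⟨r, s, fun _ => hrs⟩
    · exact ⟨0, 0, fun hh => absurd hh hlk⟩
  choose ret retD hret using hex
  let c : ℕ := Finset.univ.sup fun x : E × E => ret x.1 x.2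
  have hc : ∀ l k, ret l k ≤ c := fun l k =>
    Finset.le_sup (f := fun x : E × E => ret x.1 x.2) (Finset.mem_univ (l, k))
  set C : ℝ := (Fintype.card E : ℝ) ^ 2 with hC
  have hC0 : 0 < C := by
    have : (0 : ℝ) < Fintype.card E := Nat.cast_pos.2 Fintype.card_pos
    positivity
  -- `n` is large enough that the logarithm of the number of classes plus the cost `c z` of the
  -- returns is below `n (H - z)`, and that the returns change the drift by less than `ε`.
  obtain ⟨n, hnlog, hnε, hn1⟩ : ∃ n : ℕ, Real.log (C * (2 * R + 1) * n) + c * z < n * (H - z) ∧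
      c * (2 * R + |a|) / ε < n ∧ 1 ≤ n :=
    ((eventually_log_lt (by positivity) (sub_pos.2 hz)).and
      ((tendsto_natCast_atTop_atTop.eventually_gt_atTop _).and
        (eventually_ge_atTop 1))).exists
  have hn0 : (0 : ℝ) < n := by exact_mod_cast hn1
  let P : E × PathTail E n → ℝ := fun x => μ x.1 * weight q x.1 x.2
  let ι := {x : E × PathTail E n // 0 < P x}
  have hsum : ∀ f : E × PathTail E n → ℝ,
      ∑ i : ι, P i.1 * f i.1 = ∑ k, ∑ p : PathTail E n, μ k * weight q k p * f (k, p) := by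
    intro f
    rw [← Fintype.sum_prod_type' (f := fun k p => μ k * weight q k p * f (k, p)),
      ← Finset.sum_subtype (p := fun x => 0 < P x) (Finset.univ.filter fun x => 0 < P x)
        (by simp) (fun x => P x * f x)]
    refine Finset.sum_subset (Finset.subset_univ _) fun x _ hx => ?_
    have hx0 : P x = 0 := le_antisymm (not_lt.1 fun h0 => hx (by simp [h0]))
      (h.pathMass_nonneg x.1 x.2)
    rw [hx0, zero_mul]
  have hP1 : ∑ i : ι, P i.1 = 1 := by
    have := hsum fun _ => 1
    simpa only [mul_one, h.sum_pathMass] using this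
  have : Nonempty ι := by
    by_contra hne
    rw [not_nonempty_iff] at hne
    simp at hP1
  have hμ : ∀ i : ι, 0 < μ i.1.1 := fun i =>
    (h.nonneg _).lt_of_ne fun h0 => by have := i.2; simp [P, ← h0] at this
  have hq : ∀ i : ι, 0 < weight q i.1.1 i.1.2 := fun i => pos_of_mul_pos_right i.2 (hμ i).le
  let base : ι → E := fun i => i.1.1
  let lst : ι → E := fun i => last i.1.1 i.1.2
  let dsp : ι → ℤ := fun i => pathDisp D i.1.1 i.1.2
  let w : ι → ℕ := fun i => walkWeight T D n (base i) (lst i) (dsp i)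
  -- There is one loop per path of positive probability: its whole class, closed by the return walk.
  let len : ι → ℕ := fun i => n + ret (lst i) (base i)
  let s : ι → ℤ := fun i => dsp i + retD (lst i) (base i)
  have hr1 : ∀ i : ι, 1 ≤ walkWeight T D (ret (lst i) (base i)) (lst i) (base i)
      (retD (lst i) (base i)) := fun i =>
    hret _ _ (h.path_spec (hμ i) (hq i)).2.2.2
  have hw : ∀ i : ι, w i ≤ walkWeight T D (len i) (base i) (base i) (s i) := fun i => by
    have := (Nat.mul_le_mul (le_refl (w i)) (hr1 i)).trans (walkWeight_mul_le _ _ _ _ _ _ _)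
    rwa [mul_one] at this
  have hw1 : ∀ i, 1 ≤ w i := fun i =>
    (h.path_spec (hμ i) (hq i)).1.trans_le (weight_le_walkWeight _ _)
  obtain ⟨c₀, d₀, l, hl, hwalk⟩ := exists_walkWeight_prod hw (Q := fun k => 0 < μ k) hμ
    (fun i j => hcomp _ _ (hμ i) (hμ j)) b (fun i => hb _ (hμ i))
  obtain ⟨K, hK⟩ := exists_walkWeight_frequencies (D := D) hw1 hR hwalk (fun r => h.exists_walk hl r)
    (n := n) (c := c) hn1 (fun i => Nat.le_add_right _ _)
    (fun i => Nat.add_le_add_left (hc _ _) _) (P := fun i => P i.1)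
    (fun i => i.2.le) hP1 (x := fun i => (dsp i : ℝ)) (a := a)
    (by
      rw [← ha, ← h.sum_pathMass_mul_disp n]
      exact hsum fun x => (pathDisp D x.1 x.2 : ℝ))
    (fun i => by
      have h1 := abs_le_of_walkWeight_ne_zero hR (Nat.one_le_iff_ne_zero.1 (hr1 i))
      have h2 : ((|retD (lst i) (base i)| : ℤ) : ℝ) ≤ ((ret (lst i) (base i) * R : ℤ) : ℝ) := by
        exact_mod_cast h1
      have h3 : (ret (lst i) (base i) : ℝ) ≤ c := by exact_mod_cast hc _ _
      simp only [s]
      push_cast at h2 ⊢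
      rw [add_sub_cancel_left]
      exact h2.trans (mul_le_mul_of_nonneg_right h3 (by positivity)))
  set hbar := ∑ i : ι, P i.1 * Real.log (w i) with hhbar
  have hent := h.entropy_le hR n
  have hbar_eq : hbar = ∑ k, ∑ p : PathTail E n, μ k * weight q k p *
      Real.log (walkWeight T D n k (last k p) (pathDisp D k p)) :=
    hsum fun x => Real.log (walkWeight T D n x.1 (last x.1 x.2) (pathDisp D x.1 x.2))
  rw [← hbar_eq] at hent
  have hlogle : Real.log (C * (2 * (n * R) + 1)) ≤ Real.log (C * (2 * R + 1) * n) := by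
    refine Real.log_le_log (by positivity) ?_
    rw [mul_assoc]
    have h1n : (1 : ℝ) ≤ n := by exact_mod_cast hn1
    refine mul_le_mul_of_nonneg_left ?_ hC0.le
    nlinarith
  have hncpos : (0 : ℝ) < n + c := by positivity
  have hz' : z < hbar / (n + c) := by
    rw [lt_div_iff₀ hncpos]
    change n * H ≤ _ at hent
    linarith
  have hε' : c * (2 * R + |a|) / n < ε := by
    rw [div_lt_iff₀ hε] at hnε
    rw [div_lt_iff₀ hn0]
    linarith
  have e1 : ∀ᶠ N : ℕ in atTop, K ≤ N * (hbar / (n + c) - z) :=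
    (tendsto_natCast_atTop_atTop.atTop_mul_const (sub_pos.2 hz')).eventually_ge_atTop _
  have e2 : ∀ᶠ N : ℕ in atTop, K ≤ N * (ε - c * (2 * R + |a|) / n) :=
    (tendsto_natCast_atTop_atTop.atTop_mul_const (sub_pos.2 hε')).eventually_ge_atTop _
  filter_upwards [e1, e2, eventually_ge_atTop c₀] with N h1 h2 h3
  obtain ⟨l', s', hs', hw'⟩ := hK N h3
  refine ⟨l', s', hs'.trans ?_, le_trans (Real.exp_le_exp.2 ?_) hw'⟩
  · linarith
  · linarith

end Loops

/-! ### Upper bound: the method of types -/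

section Types
variable {E : Type} [Fintype E] [DecidableEq E] {T : E → E → ℕ} {D : E → ℤ}

/-- The number of times that a path that starts at `k` makes the step `x`. -/
def stepCount {n : ℕ} (k : E) (p : PathTail E n) (x : E × E) : ℕ :=
  total (fun i j => if (i, j) = x then 1 else 0) k p

@[simp] theorem stepCount_nil (k : E) (x : E × E) : stepCount k nil x = 0 := rfl

@[simp] theorem stepCount_cons {n : ℕ} (k j : E) (p : PathTail E n) (x : E × E) :
    stepCount k (cons j p) x = (if (k, j) = x then 1 else 0) + stepCount j p x := rfl

theorem total_eq_sum_stepCount (f : E → E → ℝ) {n : ℕ} (k : E) (p : PathTail E n) :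
    total f k p = ∑ x, (stepCount k p x : ℝ) * f x.1 x.2 := by
  induction p generalizing k with
  | nil => simp
  | cons j p ih => simp [ih, add_mul, Finset.sum_add_distrib]

theorem weight_eq_prod_stepCount {R : Type} [CommSemiring R] (M : E → E → R) {n : ℕ} (k : E)
    (p : PathTail E n) : weight M k p = ∏ x, M x.1 x.2 ^ stepCount k p x := by
  induction p generalizing k with
  | nil => simp
  | cons j p ih => 
    simp only [weight_cons, ih, stepCount_cons, pow_add, Finset.prod_mul_distrib]
    simp

theorem sum_stepCount {n : ℕ} (k : E) (p : PathTail E n) : ∑ x, stepCount k p x = n := by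
  induction p generalizing k with
  | nil => simp
  | cons j p ih => simp [ih, Finset.sum_add_distrib, add_comm]

theorem stepCount_le {n : ℕ} (k : E) (p : PathTail E n) (x : E × E) : stepCount k p x ≤ n := by
  exact (Finset.single_le_sum (fun _ _ => Nat.zero_le _) (Finset.mem_univ x)).trans_eq
    (sum_stepCount k p)

theorem sum_stepCount_mul_disp {n : ℕ} (k : E) (p : PathTail E n) :
    ∑ x, (stepCount k p x : ℝ) * D x.1 = (pathDisp D k p : ℝ) := by
  rw [← total_eq_sum_stepCount (fun i _ => (D i : ℝ))]
  unfold pathDisp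
  induction p generalizing k with
  | nil => simp
  | cons j p ih => simp [ih]

/-- `1` if `x` leaves `i`, minus `1` if `x` enters `i`. -/
def netExit (i : E) (x : E × E) : ℝ := (if x.1 = i then 1 else 0) - (if x.2 = i then 1 else 0)

/-- Exits minus entries telescope along the path, leaving only its two ends. -/
theorem abs_sum_stepCount_mul_netExit_le {n : ℕ} (k i : E) (p : PathTail E n) :
    |∑ x, (stepCount k p x : ℝ) * netExit i x| ≤ 1 := by
  have h : total (fun k l => netExit i (k, l)) k p
      = (if k = i then 1 else 0) - (if last k p = i then 1 else 0) := by
    induction p generalizing k with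
    | nil => exact (sub_self _).symm
    | cons j p ih =>
      rw [total_cons, ih, netExit, last_cons]
      ring
  rw [← total_eq_sum_stepCount (fun k l => netExit i (k, l)), h]
  split_ifs <;> simp

theorem accessible_of_stepCount {n : ℕ} {k : E} {p : PathTail E n} (hp : weight T k p ≠ 0)
    {x : E × E} (hx : stepCount k p x ≠ 0) : Accessible T k x.1 := by
  induction p generalizing k with
  | nil => simp at hx
  | cons j p ih =>
    rw [weight_cons] at hp
    by_cases h : (k, j) = x
    · subst h
      exact Accessible.refl k
    · refine (Accessible.of_ne_zero (left_ne_zero_of_mul hp)).trans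
        (ih (right_ne_zero_of_mul hp) ?_)
      simpa [h] using hx

/-- Whichever of the two steps occurs first leads to the other. -/
theorem accessible_or_of_stepCount {n : ℕ} {k : E} {p : PathTail E n} (hp : weight T k p ≠ 0)
    {x y : E × E} (hx : stepCount k p x ≠ 0) (hy : stepCount k p y ≠ 0) :
    Accessible T x.1 y.1 ∨ Accessible T y.1 x.1 := by
  induction p generalizing k with
  | nil => simp at hx
  | cons j p ih =>
    by_cases h : (k, j) = x
    · subst h
      exact Or.inl (accessible_of_stepCount hp hy)
    by_cases h' : (k, j) = y
    · subst h'
      exact Or.inr (accessible_of_stepCount hp hx)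
    rw [weight_cons] at hp
    exact ih (right_ne_zero_of_mul hp) (by simpa [h] using hx) (by simpa [h'] using hy)

/-- The row sum of a measure on pairs. -/
def rowSum (ν : E × E → ℝ) (i : E) : ℝ := ∑ j, ν (i, j)

theorem le_rowSum {ν : E × E → ℝ} (hν : ∀ x, 0 ≤ ν x) (x : E × E) : ν x ≤ rowSum ν x.1 :=
  Finset.single_le_sum (f := fun j => ν (x.1, j)) (fun _ _ => hν _) (Finset.mem_univ x.2)

variable (T) in
/-- The entropy of a measure on pairs, relative to `T`. -/
noncomputable def pairEntropy (ν : E × E → ℝ) : ℝ :=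
  ∑ x, ν x * (Real.log (T x.1 x.2) - Real.log (ν x / rowSum ν x.1))

/-- This form is continuous in `ν` also where entries or row sums vanish, as the compactness
argument needs. -/
theorem pairEntropy_eq {ν : E × E → ℝ} (hν : ∀ x, 0 ≤ ν x) :
    pairEntropy T ν = ∑ x, ν x * Real.log (T x.1 x.2) + ∑ x, Real.negMulLog (ν x)
      - ∑ i, Real.negMulLog (rowSum ν i) := by
  have h1 : ∑ i, Real.negMulLog (rowSum ν i) = ∑ x : E × E, -(ν x * Real.log (rowSum ν x.1)) := by
    rw [Fintype.sum_prod_type]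
    refine Finset.sum_congr rfl fun i _ => ?_
    simp only [Real.negMulLog]
    rw [Finset.sum_neg_distrib, ← Finset.sum_mul]
    simp [rowSum]
  rw [h1, ← Finset.sum_add_distrib, ← Finset.sum_sub_distrib]
  refine Finset.sum_congr rfl fun x _ => ?_
  rcases (hν x).eq_or_lt with h0 | h0
  · simp [← h0]
  · rw [Real.log_div h0.ne' (h0.trans_le (le_rowSum hν x)).ne', Real.negMulLog]
    ring

/-- Homogeneity of degree one converts step counts into frequencies. -/
theorem pairEntropy_div (ν : E × E → ℝ) {r : ℝ} (hr : r ≠ 0) :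
    pairEntropy T (fun x => ν x / r) = pairEntropy T ν / r := by
  have h1 : ∀ i, rowSum (fun x => ν x / r) i = rowSum ν i / r := fun i => by
    simp [rowSum, Finset.sum_div]
  simp only [pairEntropy, h1, div_div_div_cancel_right₀ hr]
  rw [Finset.sum_div]
  exact Finset.sum_congr rfl fun x _ => by ring

/-- The total weight of the paths with given step counts. -/
theorem sum_weight_stepCount_le {n : ℕ} {k : E} {p : PathTail E n} (hp : weight T k p ≠ 0) :
    ((∑ p' : PathTail E n with stepCount k p' = stepCount k p, weight T k p' : ℕ) : ℝ)
      ≤ Real.exp (pairEntropy T fun x => stepCount k p x) := by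
  set c := stepCount k p with hc
  set ν : E × E → ℝ := fun x => (c x : ℝ) with hν
  have hν0 : ∀ x, 0 ≤ ν x := fun x => Nat.cast_nonneg _
  -- The empirical kernel of the counts: it gives all paths of the type the same probability, so
  -- their number is at most the inverse of that probability.
  let q : E → E → ℝ := fun i j => ν (i, j) / rowSum ν i
  have hq0 : ∀ i j, 0 ≤ q i j := fun i j => div_nonneg (hν0 _) (Finset.sum_nonneg fun _ _ => hν0 _)
  have hq1 : ∀ i, ∑ j, q i j ≤ 1 := fun i => by
    rw [← Finset.sum_div]
    exact div_self_le_one _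
  have hT : ∀ x, c x ≠ 0 → T x.1 x.2 ≠ 0 := fun x hx h0 => by
    rw [weight_eq_prod_stepCount] at hp
    exact hp (Finset.prod_eq_zero (Finset.mem_univ x) (by rw [h0, zero_pow hx]))
  have hq : ∀ x, c x ≠ 0 → 0 < q x.1 x.2 := fun x hx => by
    have h0 : 0 < ν x := Nat.cast_pos.2 (Nat.pos_of_ne_zero hx)
    exact div_pos h0 (h0.trans_le (le_rowSum hν0 x))
  set S : Finset (PathTail E n) := {p' | stepCount k p' = c} with hS
  have hcard : (S.card : ℝ) * ∏ x : E × E, q x.1 x.2 ^ c x ≤ 1 := by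
    rw [← nsmul_eq_mul, ← Finset.sum_const]
    refine le_trans ?_ (sum_weight_le_one hq0 hq1 n k)
    refine le_trans (Finset.sum_le_sum fun p' hp' => ?_) (Finset.sum_le_sum_of_subset_of_nonneg
      (Finset.subset_univ S) fun p' _ _ => weight_nonneg hq0 k p')
    rw [weight_eq_prod_stepCount, (Finset.mem_filter.1 hp').2]
  have hsum : ((∑ p' ∈ S, weight T k p' : ℕ) : ℝ)
      = S.card * ∏ x : E × E, (T x.1 x.2 : ℝ) ^ c x := by
    have : ∀ p' ∈ S, weight T k p' = ∏ x : E × E, T x.1 x.2 ^ c x := fun p' hp' => by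
      rw [weight_eq_prod_stepCount, (Finset.mem_filter.1 hp').2]
    rw [Finset.sum_congr rfl this]
    simp
  have hexp : Real.exp (pairEntropy T ν) * ∏ x : E × E, q x.1 x.2 ^ c x
      = ∏ x : E × E, (T x.1 x.2 : ℝ) ^ c x := by
    rw [pairEntropy, Real.exp_sum, ← Finset.prod_mul_distrib]
    refine Finset.prod_congr rfl fun x _ => ?_
    by_cases hx : c x = 0
    · simp [hx, hν]
    · have h1 : (0 : ℝ) < T x.1 x.2 := Nat.cast_pos.2 (Nat.pos_of_ne_zero (hT x hx))
      rw [Real.exp_nat_mul, Real.exp_sub, Real.exp_log h1, Real.exp_log (hq x hx), ← mul_pow,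
        div_mul_cancel₀ _ (hq x hx).ne']
  rw [hsum, ← hexp, mul_left_comm]
  exact mul_le_of_le_one_right (Real.exp_pos _).le hcard

variable (T D) in
/-- The measures on pairs that are almost invariant, have almost drift `a`, and satisfy the
accessibility constraints for paths that start at `b`. -/
def almostInvariant (b : E) (a δ : ℝ) : Set (E × E → ℝ) :=
  {ν | (∀ x, 0 ≤ ν x) ∧ ∑ x, ν x = 1 ∧ (∀ i, |∑ x, ν x * netExit i x| ≤ δ) ∧
    |∑ x, ν x * D x.1 - a| ≤ δ ∧ (∀ x, ¬ (T x.1 x.2 ≠ 0 ∧ Accessible T b x.1) → ν x = 0) ∧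
    ∀ x y : E × E, ¬ (Accessible T x.1 y.1 ∨ Accessible T y.1 x.1) → ν x * ν y = 0}

/-- All constraints are closed, including the accessibility constraints, which are equations in the
entries; nonnegativity and total mass one confine `ν` to the unit cube. -/
theorem isCompact_almostInvariant (b : E) (a δ : ℝ) :
    IsCompact (almostInvariant T D b a δ) := by
  refine (isCompact_univ_pi fun _ : E × E => isCompact_Icc (a := (0 : ℝ)) (b := 1)).of_isClosed_subset
    ?_ ?_
  · simp only [almostInvariant, Set.ofPred_and, Set.ofPred_forall]
    refine (isClosed_iInter fun x => isClosed_le (by fun_prop) (by fun_prop)).inter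
      ((isClosed_eq (by fun_prop) (by fun_prop)).inter
      ((isClosed_iInter fun i => isClosed_le (by fun_prop) (by fun_prop)).inter
      ((isClosed_le (by fun_prop) (by fun_prop)).inter
      ((isClosed_iInter fun x => isClosed_iInter fun _ =>
        isClosed_eq (by fun_prop) (by fun_prop)).inter
      (isClosed_iInter fun x => isClosed_iInter fun y => isClosed_iInter fun _ =>
        isClosed_eq (by fun_prop) (by fun_prop))))))
  · intro ν hν x _
    refine ⟨hν.1 x, ?_⟩
    rw [← hν.2.1]
    exact Finset.single_le_sum (fun y _ => hν.1 y) (Finset.mem_univ x)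

theorem almostInvariant_mono {b : E} {a δ δ' : ℝ} (h : δ ≤ δ') :
    almostInvariant T D b a δ ⊆ almostInvariant T D b a δ' := fun _ hν =>
  ⟨hν.1, hν.2.1, fun i => (hν.2.2.1 i).trans h, hν.2.2.2.1.trans h, hν.2.2.2.2⟩

/-- An invariant measure on pairs is the law of two steps of a stationary chain. -/
theorem exists_isStationaryOn {b : E} {a : ℝ} {ν : E × E → ℝ}
    (hν : ν ∈ almostInvariant T D b a 0) :
    ∃ μ q, IsStationaryOn T μ q ∧ ∑ k, μ k * D k = a ∧ (∀ k, 0 < μ k → Accessible T b k) ∧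
      (∀ k l, 0 < μ k → 0 < μ l → Accessible T k l ∨ Accessible T l k) ∧
      ∑ k, ∑ l, μ k * q k l * Real.log (T k l / q k l) = pairEntropy T ν := by
  obtain ⟨h0, h1, h2, h3, h4, h5⟩ := hν
  let μ : E → ℝ := rowSum ν
  -- Rows without mass are filled with the identity to keep `q` stochastic.
  let q : E → E → ℝ := fun i j => if μ i = 0 then (if i = j then 1 else 0) else ν (i, j) / μ i
  have hμ0 : ∀ i, 0 ≤ μ i := fun i => Finset.sum_nonneg fun _ _ => h0 _
  have hμq : ∀ i j, μ i * q i j = ν (i, j) := fun i j => by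
    by_cases hi : μ i = 0
    · have := le_rowSum h0 (i, j)
      rw [show rowSum ν (i, j).1 = 0 from hi] at this
      rw [hi, zero_mul]
      exact (h0 _).antisymm this
    · simp only [q, if_neg hi]
      exact mul_div_cancel₀ _ hi
  have hpos : ∀ i, 0 < μ i → ∃ j, ν (i, j) ≠ 0 := fun i hi => by
    obtain ⟨j, -, hj⟩ := Finset.exists_ne_zero_of_sum_ne_zero hi.ne'
    exact ⟨j, hj⟩
  refine ⟨μ, q, ⟨?_, ?_, hμ0, ?_, ?_, ?_⟩, ?_, ?_, ?_, ?_⟩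
  · intro i j
    simp only [q]
    split_ifs
    · exact zero_le_one
    · exact le_rfl
    · exact div_nonneg (h0 _) (hμ0 _)
  · intro i
    by_cases hi : μ i = 0
    · simp [q, hi]
    · simp only [q, if_neg hi, ← Finset.sum_div]
      exact div_self hi
  · rw [← h1, Fintype.sum_prod_type]
    rfl
  · intro l
    simp only [hμq]
    -- For `δ = 0` the net exit from `l` vanishes: row sum equals column sum.
    have h6 := abs_nonpos_iff.1 (h2 l)
    simp only [netExit, mul_sub, Finset.sum_sub_distrib, mul_ite, mul_one, mul_zero,
      Fintype.sum_prod_type, Finset.sum_ite_eq', Finset.mem_univ, if_true] at h6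
    rw [Finset.sum_comm] at h6
    simp only [Finset.sum_ite_eq', Finset.mem_univ, if_true] at h6
    exact (sub_eq_zero.1 h6).symm
  · intro k l hkl
    rw [hμq] at hkl
    by_contra hT
    exact hkl (h4 (k, l) fun hh => hh.1 hT)
  · have := abs_nonpos_iff.1 h3
    rw [← sub_eq_zero.1 this, Fintype.sum_prod_type]
    refine Finset.sum_congr rfl fun k _ => ?_
    exact Finset.sum_mul _ _ _
  · intro k hk
    obtain ⟨j, hj⟩ := hpos k hk
    by_contra hcon
    exact hj (h4 (k, j) fun hh => hcon hh.2)
  · intro k l hk hl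
    obtain ⟨i, hi⟩ := hpos k hk
    obtain ⟨j, hj⟩ := hpos l hl
    by_contra hcon
    exact mul_ne_zero hi hj (h5 (k, i) (l, j) hcon)
  · rw [pairEntropy, Fintype.sum_prod_type]
    refine Finset.sum_congr rfl fun k _ => Finset.sum_congr rfl fun l _ => ?_
    rw [hμq]
    by_cases hkl : ν (k, l) = 0
    · simp [hkl]
    have hk : μ k ≠ 0 := fun h => hkl (by rw [← hμq, h, zero_mul])
    have hT : T k l ≠ 0 := by
      by_contra hT
      exact hkl (h4 (k, l) fun hh => hh.1 hT)
    simp only [q, if_neg hk]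
    rw [Real.log_div (Nat.cast_ne_zero.2 hT) (div_ne_zero hkl hk)]

/-- Counterexamples for every `δ = 1 / (m + 1)` would give nested nonempty compact sets; a common
point is exactly invariant and has entropy at least `z`. -/
theorem exists_forall_pairEntropy_lt {b : E} {a z : ℝ}
    (hz : ∀ ν ∈ almostInvariant T D b a 0, pairEntropy T ν < z) :
    ∃ δ > 0, ∀ ν ∈ almostInvariant T D b a δ, pairEntropy T ν < z := by
  let G : (E × E → ℝ) → ℝ := fun ν => ∑ x, ν x * Real.log (T x.1 x.2)
    + ∑ x, Real.negMulLog (ν x) - ∑ i, Real.negMulLog (rowSum ν i)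
  have hG : Continuous G := by
    unfold G rowSum
    have := Real.continuous_negMulLog
    fun_prop
  by_contra! hcon
  let t : ℕ → Set (E × E → ℝ) := fun m =>
    almostInvariant T D b a (1 / ((m : ℝ) + 1)) ∩ {ν | z ≤ G ν}
  have hcl : IsClosed {ν | z ≤ G ν} := isClosed_le continuous_const hG
  obtain ⟨ν, hν⟩ := IsCompact.nonempty_iInter_of_sequence_nonempty_isCompact_isClosed t
    (fun m => Set.inter_subset_inter_left _ (almostInvariant_mono (by
      push_cast
      exact one_div_le_one_div_of_le (by positivity) (by linarith))))
    (fun m => by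
      obtain ⟨ν, h1, h2⟩ := hcon (1 / ((m : ℝ) + 1)) (by positivity)
      exact ⟨ν, h1, by rwa [pairEntropy_eq h1.1] at h2⟩)
    ((isCompact_almostInvariant _ _ _).inter_right hcl)
    (fun m => (isCompact_almostInvariant _ _ _).isClosed.inter hcl)
  have hνm := Set.mem_iInter.1 hν
  have hlim : ∀ r : ℝ, (∀ m : ℕ, r ≤ 1 / ((m : ℝ) + 1)) → r ≤ 0 := fun r hr =>
    ge_of_tendsto' tendsto_one_div_add_atTop_nhds_zero_nat hr
  have h0 := (hνm 0).1
  refine (hz ν ⟨h0.1, h0.2.1, fun i => hlim _ fun m => (hνm m).1.2.2.1 i,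
    hlim _ fun m => (hνm m).1.2.2.2.1, h0.2.2.2.2⟩).not_ge ?_
  rw [pairEntropy_eq h0.1]
  exact (hνm 0).2

/-- The total weight of the paths with drift close to `a` grows at most at the largest entropy of the
stationary chains with drift `a`. -/
theorem eventually_sum_weight_le {b : E} {a z : ℝ}
    (hz : ∀ μ q, IsStationaryOn T μ q → ∑ k, μ k * D k = a → (∀ k, 0 < μ k → Accessible T b k) →
      (∀ k l, 0 < μ k → 0 < μ l → Accessible T k l ∨ Accessible T l k) →
      ∑ k, ∑ l, μ k * q k l * Real.log (T k l / q k l) < z) :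
    ∃ ε > 0, ∀ᶠ N : ℕ in atTop,
      ((∑ p : PathTail E N with |(pathDisp D b p : ℝ) - N * a| ≤ ε * N, weight T b p : ℕ) : ℝ)
        ≤ ((N : ℝ) + 1) ^ Fintype.card (E × E) * Real.exp (N * z) := by
  obtain ⟨δ, hδ, h⟩ := exists_forall_pairEntropy_lt (T := T) (D := D) (b := b) (a := a) (z := z)
    fun ν hν => by
      obtain ⟨μ, q, h1, h2, h3, h4, h5⟩ := exists_isStationaryOn hν
      rw [← h5]
      exact hz μ q h1 h2 h3 h4
  refine ⟨δ, hδ, ?_⟩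
  -- The net exit of a path is at most `1`, hence at most `δ` after division by `N`.
  have hδN : ∀ᶠ N : ℕ in atTop, 1 ≤ N * δ :=
    (tendsto_natCast_atTop_atTop.atTop_mul_const hδ).eventually_ge_atTop _
  filter_upwards [hδN, eventually_ge_atTop 1] with N hN1 hN2
  have hN0 : (0 : ℝ) < N := by exact_mod_cast hN2
  -- All possible types: every count is at most `N`, which gives the polynomial factor.
  let S : Finset (E × E → ℕ) := Fintype.piFinset fun _ => Finset.range (N + 1)
  rw [← Finset.sum_fiberwise_of_maps_to (t := S) (g := fun p => stepCount b p)]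
  swap
  · intro p _
    exact Fintype.mem_piFinset.2 fun x => Finset.mem_range_succ_iff.2 (stepCount_le b p x)
  have hS : ((N : ℝ) + 1) ^ Fintype.card (E × E) = (S.card : ℝ) := by
    simp [S]
  rw [hS, ← nsmul_eq_mul (S.card), ← Finset.sum_const, Nat.cast_sum]
  refine Finset.sum_le_sum fun c _ => ?_
  by_cases hex : ∃ p : PathTail E N, |(pathDisp D b p : ℝ) - N * a| ≤ δ * N ∧
      stepCount b p = c ∧ weight T b p ≠ 0
  swap
  · push Not at hex
    rw [Finset.sum_eq_zero]
    · simpa using (Real.exp_pos _).le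
    · intro p hp
      simp only [Finset.mem_filter, Finset.mem_univ, true_and] at hp
      exact hex p hp.1 hp.2
  obtain ⟨p, hp1, rfl, hp2⟩ := hex
  have hle : ((∑ p' ∈ ({p' : PathTail E N | |(pathDisp D b p' : ℝ) - N * a| ≤ δ * N} :
      Finset (PathTail E N)) with stepCount b p' = stepCount b p, weight T b p' : ℕ) : ℝ)
      ≤ ((∑ p' : PathTail E N with stepCount b p' = stepCount b p, weight T b p' : ℕ) : ℝ) := by
    exact_mod_cast Finset.sum_le_sum_of_subset
      (Finset.filter_subset_filter _ (Finset.subset_univ _))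
  refine (hle.trans (sum_weight_stepCount_le hp2)).trans (Real.exp_le_exp.2 ?_)
  have hmem : (fun x => (stepCount b p x : ℝ) / N) ∈ almostInvariant T D b a δ := by
    refine ⟨fun x => by positivity, ?_, fun i => ?_, ?_, fun x hx => ?_, fun x y hxy => ?_⟩
    · rw [← Finset.sum_div, ← Nat.cast_sum, sum_stepCount, div_self hN0.ne']
    · have := abs_sum_stepCount_mul_netExit_le b i p
      simp only [div_mul_eq_mul_div]
      rw [← Finset.sum_div, abs_div, abs_of_pos hN0, div_le_iff₀ hN0]
      linarith
    · simp only [div_mul_eq_mul_div]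
      rw [← Finset.sum_div, sum_stepCount_mul_disp]
      have e : (pathDisp D b p : ℝ) / N - a = (pathDisp D b p - N * a) / N := by
        field_simp
      rw [e, abs_div, abs_of_pos hN0, div_le_iff₀ hN0]
      exact hp1
    · by_contra hne
      have hc : stepCount b p x ≠ 0 := fun h0 => hne (by simp [h0])
      refine hx ⟨fun h0 => ?_, accessible_of_stepCount hp2 hc⟩
      rw [weight_eq_prod_stepCount] at hp2
      exact hp2 (Finset.prod_eq_zero (Finset.mem_univ x) (by rw [h0, zero_pow hc]))
    · by_contra hne
      refine hxy (accessible_or_of_stepCount hp2 (fun h0 => hne ?_) fun h0 => hne ?_) <;> simp [h0]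
  have := h _ hmem
  rw [pairEntropy_div _ hN0.ne', div_lt_iff₀ hN0] at this
  linarith

end Types

/-! ### Defect dynamics: linearity and translations -/

namespace CellularAutomaton

variable (A : CellularAutomaton) (η : ℤ → Bool)

theorem traj_add (s t : ℕ) : A.traj η (s + t) = A.traj (A.traj η s) t := by
  simp only [traj, ← Function.iterate_add_apply, add_comm s t]

theorem change_add (s t : ℕ) (y x : ℤ) :
    A.change η (s + t) y x = A.change (A.traj η s) t y x := by
  simp only [change, add_assoc, traj_add]

theorem change_le_one (t : ℕ) (y x : ℤ) : A.change η t y x ≤ 1 := by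
  unfold change
  split_ifs <;> simp

theorem defect_add (Δ : ℤ → ℕ) (s t : ℕ) :
    A.defect η Δ (s + t) = A.defect (A.traj η s) (A.defect η Δ s) t := by
  induction t with
  | zero => rfl
  | succ t ih =>
    funext x
    rw [← add_assoc]
    simp only [defect, ih, change_add]

/-- Superposition: the trajectory is fixed, so the dynamics is linear in the initial defects. -/
theorem defect_eq_sum {Δ : ℤ → ℕ} {s : Finset ℤ} (hs : ∀ y, Δ y ≠ 0 → y ∈ s) (t : ℕ) (x : ℤ) :
    A.defect η Δ t x = ∑ y ∈ s, Δ y * A.defect η (Pi.single y 1) t x := by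
  induction t generalizing x with
  | zero =>
    by_cases hx : x ∈ s
    · simp [defect, Pi.single_apply, hx]
    · have : Δ x = 0 := by
        by_contra h
        exact hx (hs x h)
      simp [defect, Pi.single_apply, this]
  | succ t ih =>
    simp only [defect, ih, Finset.mul_sum]
    rw [Finset.sum_comm]
    exact Finset.sum_congr rfl fun y _ => Finset.sum_congr rfl fun v _ => mul_left_comm _ _ _

section Shift
variable (c : ℤ)

theorem globalMap_shift : A.globalMap (fun x => η (x - c)) = fun x => A.globalMap η (x - c) := by
  funext x
  simp only [globalMap, add_sub_right_comm]

theorem traj_shift (t : ℕ) : A.traj (fun x => η (x - c)) t = fun x => A.traj η t (x - c) := by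
  induction t with
  | zero => rfl
  | succ t ih =>
    simp only [traj, Function.iterate_succ_apply'] at ih ⊢
    rw [ih, globalMap_shift]

theorem perturb_shift (y : ℤ) :
    perturb (fun x => η (x - c)) y = fun x => perturb η (y - c) (x - c) := by
  funext x
  simp [perturb, Function.update_apply]

theorem change_shift (t : ℕ) (y x : ℤ) :
    A.change (fun x => η (x - c)) t y x = A.change η t (y - c) (x - c) := by
  simp only [change, traj_shift, perturb_shift, globalMap_shift]

theorem defect_shift (Δ : ℤ → ℕ) (t : ℕ) (x : ℤ) :
    A.defect (fun x => η (x - c)) (fun x => Δ (x - c)) t x = A.defect η Δ t (x - c) := by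
  induction t generalizing x with
  | zero => rfl
  | succ t ih => simp only [defect, ih, change_shift, add_sub_right_comm]

theorem defect_shift_single (y : ℤ) (t : ℕ) (x : ℤ) :
    A.defect (fun x => η (x - c)) (Pi.single y 1) t x
      = A.defect η (Pi.single (y - c) 1) t (x - c) := by
  rw [← defect_shift]
  congr 1
  funext z
  simp [Pi.single_apply]

end Shift

variable {A η}

/-! ### Doubly periodic states and paths in the expansion graph -/

theorem IsDoublyPeriodic.spatialPeriod_spec (hη : A.IsDoublyPeriodic η) :
    1 ≤ spatialPeriod η ∧ ∀ x : ℤ, η x = η (x % (spatialPeriod η : ℤ)) :=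
  Nat.sInf_mem (s := {s : ℕ | 1 ≤ s ∧ ∀ x : ℤ, η x = η (x % (s : ℤ))}) hη.2

theorem IsDoublyPeriodic.shiftPeriod_spec (hη : A.IsDoublyPeriodic η) :
    1 ≤ A.shiftPeriod η ∧ ∃ s < spatialPeriod η, A.ShiftsBy η (A.shiftPeriod η) s := by
  obtain ⟨⟨p, hp1, hp⟩, -⟩ := id hη
  refine Nat.sInf_mem (s := {p : ℕ | 1 ≤ p ∧ ∃ s < spatialPeriod η, A.ShiftsBy η p s})
    ⟨p, hp1, 0, hη.spatialPeriod_spec.1, fun x => ?_⟩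
  simp [hp]

theorem IsDoublyPeriodic.traj_shiftPeriod (hη : A.IsDoublyPeriodic η) :
    A.traj η (A.shiftPeriod η) = fun x => η (x - (A.shift η : ℤ)) := by
  obtain ⟨s, hs⟩ := hη.shiftPeriod_spec.2
  exact funext (Nat.sInf_mem
    (s := {s : ℕ | s < spatialPeriod η ∧ A.ShiftsBy η (A.shiftPeriod η) s}) ⟨s, hs⟩).2

/-- `η` is invariant under translation by the multiple `σ ⌊i / σ⌋` of its period. -/
theorem IsDoublyPeriodic.defect_mod (hη : A.IsDoublyPeriodic η) (t : ℕ) (i x : ℤ) :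
    A.defect η (Pi.single i 1) t x
      = A.defect η (Pi.single (i % spatialPeriod η) 1) t (i % spatialPeriod η + (x - i)) := by
  set σ : ℤ := (spatialPeriod η : ℤ)
  have h : (fun x => η (x - σ * (i / σ))) = η := by
    funext x
    rw [hη.spatialPeriod_spec.2, hη.spatialPeriod_spec.2 x, Int.sub_mul_emod_self_left]
  have h2 := A.defect_shift_single η (σ * (i / σ)) i t x
  rw [h] at h2
  have h3 := Int.emod_add_mul_ediv i σ
  rw [h2]
  congr 1
  · congr 1
    linarith
  · linarith

/-- A sum over the offspring of a single defect, as a sum over edges. -/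
theorem IsDoublyPeriodic.sum_offspring (hη : A.IsDoublyPeriodic η) (i : ℤ) {s : Finset ℤ}
    (hs : ∀ y, y ∈ s ↔ A.defect η (Pi.single i 1) (A.shiftPeriod η) y ≠ 0) (f : ℤ → ℕ) :
    ∑ y ∈ s, A.defect η (Pi.single i 1) (A.shiftPeriod η) y * f y
      = ∑ b : A.Edge η, if b.source = i % spatialPeriod η then b.size * f (i + b.disp) else 0 := by
  have hσ : (0 : ℤ) < spatialPeriod η := by exact_mod_cast hη.spatialPeriod_spec.1
  have hsize : ∀ b : A.Edge η, b.source = i % spatialPeriod η →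
      b.size = A.defect η (Pi.single i 1) (A.shiftPeriod η) (i + b.disp) := fun b hb => by
    rw [hη.defect_mod _ i, Edge.size, offspring, hb, add_sub_cancel_left]
  rw [← Finset.sum_filter]
  symm
  refine Finset.sum_bij (fun b _ => i + b.disp) ?_ ?_ ?_ ?_
  · intro b hb
    rw [hs, ← hsize b (Finset.mem_filter.1 hb).2]
    exact b.2
  · intro b hb b' hb' hbb
    have h1 : b.source = b'.source :=
      (Finset.mem_filter.1 hb).2.trans (Finset.mem_filter.1 hb').2.symm
    have h2 : b.disp = b'.disp := add_left_cancel hbb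
    exact Subtype.ext (Prod.ext (Fin.ext (Int.natCast_inj.1 h1)) h2)
  · intro y hy
    have h0 := Int.emod_nonneg i hσ.ne'
    have h1 := Int.emod_lt_of_pos i hσ
    have hsrc : (((i % (spatialPeriod η : ℤ)).toNat : ℕ) : ℤ) = i % spatialPeriod η :=
      Int.toNat_of_nonneg h0
    refine ⟨⟨(⟨(i % (spatialPeriod η : ℤ)).toNat, by omega⟩, y - i), ?_⟩, ?_, ?_⟩
    · rw [hs, hη.defect_mod] at hy
      simp only [offspring, hsrc]
      exact hy
    · exact Finset.mem_filter.2 ⟨Finset.mem_univ _, hsrc⟩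
    · exact add_sub_cancel i y
  · intro b hb
    rw [hsize b (Finset.mem_filter.1 hb).2]

/-- After one shift period the state is `η` translated by `σ₀`; moved back by `σ₀`, every offspring
starts afresh in `η`. -/
theorem IsDoublyPeriodic.defect_succ (hη : A.IsDoublyPeriodic η) (n : ℕ) (i x : ℤ) :
    A.defect η (Pi.single i 1) ((n + 1) * A.shiftPeriod η) x
      = ∑ b : A.Edge η, if b.source = i % spatialPeriod η then
          b.size * A.defect η (Pi.single (i + b.disp - A.shift η) 1) (n * A.shiftPeriod η)
            (x - A.shift η) else 0 := by
  have hfin := A.defect_support_finite η (Pi.single i 1)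
    ((Set.finite_singleton i).subset Pi.support_single_subset) (A.shiftPeriod η)
  have hs : ∀ y, y ∈ hfin.toFinset ↔ A.defect η (Pi.single i 1) (A.shiftPeriod η) y ≠ 0 := by
    simp
  rw [add_mul, one_mul, add_comm, defect_add, hη.traj_shiftPeriod,
    defect_eq_sum _ _ (fun y => (hs y).2)]
  simp only [defect_shift_single]
  exact hη.sum_offspring i hs fun y =>
    A.defect η (Pi.single (y - A.shift η) 1) (n * A.shiftPeriod η) (x - A.shift η)

variable (A η) in
/-- The entries of the matrix `T`. -/
noncomputable def stepWeight (k l : A.Edge η) : ℕ := A.edgeMatrix η k l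

/-- The defects at a multiple of the shift period, as a sum over the paths in the expansion
graph. -/
theorem IsDoublyPeriodic.defect_eq_sum_paths (hη : A.IsDoublyPeriodic η) (n : ℕ) (i x : ℤ) :
    A.defect η (Pi.single i 1) ((n + 1) * A.shiftPeriod η) x
      = ∑ b : A.Edge η, if b.source = i % spatialPeriod η then
          ∑ p : PathTail (A.Edge η) n,
            if i + (pathDisp Edge.disp b p + (last b p).disp) = x then
              weight (A.stepWeight η) b p * (last b p).size else 0
        else 0 := by
  induction n generalizing i x with
  | zero =>
    -- One period is one edge, so a path of `n` steps accounts for `n + 1` periods. A step carries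
    -- the data of the edge it leaves, hence the last edge adds its size and displacement
    -- separately.
    rw [hη.defect_succ]
    refine Finset.sum_congr rfl fun b _ => ?_
    congr 1
    rw [PathTail.sum_zero, zero_mul]
    simp only [defect, Pi.single_apply, pathDisp, total_nil, last_nil, weight_nil, zero_add,
      one_mul, mul_ite, mul_one, mul_zero, sub_left_inj]
    simp only [eq_comm]
  | succ n ih =>
    rw [hη.defect_succ]
    refine Finset.sum_congr rfl fun b _ => ?_
    by_cases hb : b.source = i % spatialPeriod η
    swap
    · simp [hb]
    rw [if_pos hb, if_pos hb, ih, PathTail.sum_succ, Finset.mul_sum]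
    refine Finset.sum_congr rfl fun l _ => ?_
    have ht : b.target = (i + b.disp - A.shift η) % spatialPeriod η := by
      rw [Edge.target, hb]
      simp only [Int.sub_emod, Int.add_emod, Int.emod_emod]
    have hT : A.stepWeight η b l
        = if l.source = (i + b.disp - A.shift η) % spatialPeriod η then b.size else 0 := by
      rw [stepWeight, edgeMatrix, ht]
      simp only [eq_comm]
    by_cases hl : l.source = (i + b.disp - A.shift η) % spatialPeriod η
    · rw [if_pos hl] at hT ⊢
      rw [Finset.mul_sum]
      refine Finset.sum_congr rfl fun p _ => ?_
      rw [mul_ite, mul_zero, last_cons, weight_cons, hT, mul_assoc]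
      refine if_congr ?_ rfl rfl
      simp only [pathDisp, total_cons]
      -- The shift `σ₀` moves start and target alike and cancels from the displacements.
      constructor <;> intro h <;> linarith
    · rw [if_neg hl] at hT ⊢
      rw [mul_zero, eq_comm]
      refine Finset.sum_eq_zero fun p _ => ?_
      rw [weight_cons, hT, zero_mul, zero_mul, ite_self]

/-! ### Defects in a set of sites and finite propagation speed -/

variable (A η) in
/-- The number of defects in a set. -/
noncomputable def defectMass (Δ₀ : ℤ → ℕ) (t : ℕ) (U : Set ℤ) : ℝ≥0∞ :=
  ∑' x : U, (A.defect η Δ₀ t x : ℝ≥0∞)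

-- Each path ends at a single site, so summing over sites leaves one term per path.
open Classical in
theorem IsDoublyPeriodic.defectMass_eq (hη : A.IsDoublyPeriodic η) {Δ₀ : ℤ → ℕ} {s : Finset ℤ}
    (hs : ∀ y, Δ₀ y ≠ 0 → y ∈ s) (n : ℕ) (U : Set ℤ) :
    A.defectMass η Δ₀ ((n + 1) * A.shiftPeriod η) U
      = ((∑ i ∈ s, ∑ b : A.Edge η, ∑ p : PathTail (A.Edge η) n,
          if b.source = i % spatialPeriod η ∧
            i + (pathDisp Edge.disp b p + (last b p).disp) ∈ U then
          Δ₀ i * (weight (A.stepWeight η) b p * (last b p).size) else 0 : ℕ) : ℝ≥0∞) := by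
  have h1 : ∀ x, U.indicator (fun x => (A.defect η Δ₀ ((n + 1) * A.shiftPeriod η) x : ℝ≥0∞)) x
      = ∑ i ∈ s, ∑ b : A.Edge η, ∑ p : PathTail (A.Edge η) n,
        if x = i + (pathDisp Edge.disp b p + (last b p).disp) then
          ((if b.source = i % spatialPeriod η ∧
            i + (pathDisp Edge.disp b p + (last b p).disp) ∈ U then
          Δ₀ i * (weight (A.stepWeight η) b p * (last b p).size) else 0 : ℕ) : ℝ≥0∞) else 0 := by
    intro x
    have h2 : U.indicator (fun x => (A.defect η Δ₀ ((n + 1) * A.shiftPeriod η) x : ℝ≥0∞)) x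
        = ((if x ∈ U then A.defect η Δ₀ ((n + 1) * A.shiftPeriod η) x else 0 : ℕ) : ℝ≥0∞) := by
      rw [Set.indicator_apply]
      split_ifs <;> simp
    have h3 : (if x ∈ U then A.defect η Δ₀ ((n + 1) * A.shiftPeriod η) x else 0)
        = ∑ i ∈ s, ∑ b : A.Edge η, ∑ p : PathTail (A.Edge η) n,
        if x = i + (pathDisp Edge.disp b p + (last b p).disp) then
          (if b.source = i % spatialPeriod η ∧
            i + (pathDisp Edge.disp b p + (last b p).disp) ∈ U then
          Δ₀ i * (weight (A.stepWeight η) b p * (last b p).size) else 0) else 0 := by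
      by_cases hx : x ∈ U
      · rw [if_pos hx, defect_eq_sum _ _ hs]
        refine Finset.sum_congr rfl fun i _ => ?_
        rw [hη.defect_eq_sum_paths, Finset.mul_sum]
        refine Finset.sum_congr rfl fun b _ => ?_
        by_cases hb : b.source = i % spatialPeriod η
        · rw [if_pos hb, Finset.mul_sum]
          refine Finset.sum_congr rfl fun p _ => ?_
          by_cases hp : i + (pathDisp Edge.disp b p + (last b p).disp) = x
          · rw [if_pos hp, if_pos hp.symm, if_pos ⟨hb, hp ▸ hx⟩]
          · rw [if_neg hp, if_neg (Ne.symm hp), mul_zero]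
        · simp [hb]
      · rw [if_neg hx, eq_comm]
        refine Finset.sum_eq_zero fun i _ => Finset.sum_eq_zero fun b _ =>
          Finset.sum_eq_zero fun p _ => ?_
        by_cases hp : x = i + (pathDisp Edge.disp b p + (last b p).disp)
        · rw [if_pos hp, if_neg fun h => hx (hp ▸ h.2)]
        · rw [if_neg hp]
    rw [h2, h3]
    push_cast
    rfl
  rw [defectMass, tsum_subtype U fun x => (A.defect η Δ₀ ((n + 1) * A.shiftPeriod η) x : ℝ≥0∞)]
  simp only [h1]
  rw [Summable.tsum_finsetSum fun _ _ => ENNReal.summable]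
  push_cast
  refine Finset.sum_congr rfl fun i _ => ?_
  rw [Summable.tsum_finsetSum fun _ _ => ENNReal.summable]
  refine Finset.sum_congr rfl fun b _ => ?_
  rw [Summable.tsum_finsetSum fun _ _ => ENNReal.summable]
  refine Finset.sum_congr rfl fun p _ => ?_
  rw [tsum_ite_eq]

variable {Δ₀ : ℤ → ℕ}

/-- A defect passes to at most one site per neighborhood element, within distance `R`. The extra `1`
keeps the factor at least one even for an empty neighborhood. -/
theorem defectMass_succ_le {R : ℕ} (hR : ∀ v ∈ A.nbhd, |v| ≤ R) (t : ℕ) {U V : Set ℤ}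
    (hUV : ∀ x ∈ U, ∀ y, |y - x| ≤ R → y ∈ V) :
    A.defectMass η Δ₀ (t + 1) U ≤ ((A.nbhd.card + 1 : ℕ) : ℝ≥0∞) * A.defectMass η Δ₀ t V := by
  rw [defectMass, defectMass, tsum_subtype U fun x => (A.defect η Δ₀ (t + 1) x : ℝ≥0∞),
    tsum_subtype V fun x => (A.defect η Δ₀ t x : ℝ≥0∞)]
  set g := V.indicator fun x => (A.defect η Δ₀ t x : ℝ≥0∞) with hg
  calc _ ≤ ∑' x, ∑ v ∈ A.nbhd, g (x + v) := by
        refine ENNReal.tsum_le_tsum fun x => ?_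
        by_cases hx : x ∈ U
        · rw [Set.indicator_of_mem hx]
          simp only [defect]
          push_cast
          refine Finset.sum_le_sum fun v hv => ?_
          rw [hg, Set.indicator_of_mem (hUV x hx _ (by simpa using hR v hv))]
          exact mul_le_of_le_one_left' (by exact_mod_cast change_le_one A η t _ _)
        · rw [Set.indicator_of_notMem hx]
          exact zero_le
    _ = ∑ v ∈ A.nbhd, ∑' x, g (x + v) := Summable.tsum_finsetSum fun _ _ => ENNReal.summable
    _ = ∑ _v ∈ A.nbhd, ∑' x, g x :=
        Finset.sum_congr rfl fun v _ => (Equiv.addRight v).tsum_eq g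
    _ ≤ _ := by
        rw [Finset.sum_const, nsmul_eq_mul]
        gcongr
        exact Nat.le_succ _

theorem defectMass_add_le {R : ℕ} (hR : ∀ v ∈ A.nbhd, |v| ≤ R) (t r : ℕ) {U V : Set ℤ}
    (hUV : ∀ x ∈ U, ∀ y, |y - x| ≤ r * R → y ∈ V) :
    A.defectMass η Δ₀ (t + r) U
      ≤ ((A.nbhd.card + 1 : ℕ) : ℝ≥0∞) ^ r * A.defectMass η Δ₀ t V := by
  induction r generalizing U with
  | zero =>
    rw [pow_zero, one_mul, add_zero]
    exact ENNReal.tsum_mono_subtype (fun x => (A.defect η Δ₀ t x : ℝ≥0∞)) fun x hx => hUV x hx x (by simp)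
  | succ r ih =>
    refine (defectMass_succ_le hR (t + r) (V := {y | ∃ x ∈ U, |y - x| ≤ R})
      fun x hx y hy => ⟨x, hx, hy⟩).trans ?_
    rw [pow_succ', mul_assoc]
    refine mul_le_mul_right (ih ?_) _
    rintro x ⟨x', hx', hxx'⟩ y hy
    refine hUV x' hx' y ?_
    have := abs_sub_le y x x'
    push_cast
    linarith

/-- The sites `x` with `|x / t - α| < ε`. -/
def window (α ε : ℝ) (t : ℕ) : Set ℤ := {x | |(x : ℝ) / (t : ℝ) - α| < ε}

theorem mem_window {α ε : ℝ} {t : ℕ} (ht : 0 < t) {x : ℤ} :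
    x ∈ window α ε t ↔ |(x : ℝ) - t * α| < ε * t := by
  have ht' : (0 : ℝ) < t := by exact_mod_cast ht
  have e : (x : ℝ) / t - α = (x - t * α) / t := by field_simp
  rw [window, Set.mem_ofPred_eq, e, abs_div, abs_of_pos ht', div_lt_iff₀ ht']

/-- The centres `t α` and `t' α` differ by at most `|α| p`; the slack `(ε' - ε) t'`, growing
linearly, absorbs all bounded errors. -/
theorem window_thickening {α ε ε' : ℝ} {t t' p M : ℕ} (ht : 0 < t) (ht' : 0 < t') (hε : 0 ≤ ε)
    (h1 : t ≤ t' + p) (h2 : t' ≤ t + p) (h : M + |α| * p + ε * p ≤ (ε' - ε) * t')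
    {x y : ℤ} (hx : x ∈ window α ε t) (hy : |y - x| ≤ M) : y ∈ window α ε' t' := by
  rw [mem_window ht] at hx
  rw [mem_window ht']
  have h1' : (t : ℝ) ≤ t' + p := by exact_mod_cast h1
  have h2' : (t' : ℝ) ≤ t + p := by exact_mod_cast h2
  have hy' : |(y : ℝ) - x| ≤ M := by exact_mod_cast hy
  have h3 : |((t : ℝ) - t') * α| ≤ p * |α| := by
    rw [abs_mul]
    exact mul_le_mul_of_nonneg_right (abs_le.2 ⟨by linarith, by linarith⟩) (abs_nonneg _)
  have h4 : ε * t ≤ ε * (t' + p) := mul_le_mul_of_nonneg_left h1' hε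
  have e : (y : ℝ) - t' * α = (y - x) + (x - t * α) + (t - t') * α := by ring
  rw [e]
  have h5 := abs_add_le ((y : ℝ) - x + (x - t * α)) ((t - t') * α)
  have h6 := abs_add_le ((y : ℝ) - x) (x - t * α)
  linarith

theorem eventually_mul_pow_mul_exp_le (K : ℝ) (k : ℕ) {z z' : ℝ} (hz : z' < z) :
    ∀ᶠ N : ℕ in atTop, K * (((N : ℝ) + 1) ^ k * Real.exp (N * z')) ≤ Real.exp (N * z) := by
  set δ := z - z' with hδ
  have hr : |Real.exp (-δ)| < 1 := by
    rw [abs_of_pos (Real.exp_pos _), Real.exp_lt_one_iff]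
    linarith
  have h1 := ((tendsto_pow_const_mul_const_pow_of_abs_lt_one k hr).comp
    (tendsto_add_atTop_nat 1)).eventually_lt_const
    (show 0 < Real.exp (-δ) / (|K| + 1) by positivity)
  filter_upwards [h1] with N hN
  simp only [Function.comp, pow_succ (Real.exp (-δ)) N] at hN
  rw [lt_div_iff₀ (by positivity)] at hN
  push_cast at hN
  have h2 : ((N : ℝ) + 1) ^ k * Real.exp (-δ) ^ N * (|K| + 1) ≤ 1 := by
    refine le_of_mul_le_mul_right ?_ (Real.exp_pos (-δ))
    rw [one_mul]
    linarith
  have h3 : Real.exp (N * z') = Real.exp (-δ) ^ N * Real.exp (N * z) := by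
    rw [← Real.exp_nat_mul, ← Real.exp_add]
    congr 1
    rw [hδ]
    ring
  rw [h3]
  have h4 : K ≤ |K| + 1 := by linarith [le_abs_self K]
  calc K * (((N : ℝ) + 1) ^ k * (Real.exp (-δ) ^ N * Real.exp (N * z)))
      ≤ (|K| + 1) * (((N : ℝ) + 1) ^ k * (Real.exp (-δ) ^ N * Real.exp (N * z))) :=
        mul_le_mul_of_nonneg_right h4 (by positivity)
    _ = ((N : ℝ) + 1) ^ k * Real.exp (-δ) ^ N * (|K| + 1) * Real.exp (N * z) := by ring
    _ ≤ _ := mul_le_of_le_one_left (Real.exp_pos _).le h2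

/-! ### Bounds along the multiples of the shift period -/

theorem exists_disp_le (A : CellularAutomaton) (η : ℤ → Bool) (s : Finset ℤ) :
    ∃ M : ℕ, ∀ i ∈ s, ∀ e : A.Edge η, |i + e.disp| ≤ M := by
  refine ⟨(s ×ˢ Finset.univ).sup fun x : ℤ × A.Edge η => (x.1 + x.2.disp).natAbs,
    fun i hi e => ?_⟩
  have := Finset.le_sup (f := fun x : ℤ × A.Edge η => (x.1 + x.2.disp).natAbs)
    (Finset.mk_mem_product hi (Finset.mem_univ e))
  rw [Int.abs_eq_natAbs]
  exact_mod_cast this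

theorem IsDoublyPeriodic.eventually_defectMass_le (hη : A.IsDoublyPeriodic η)
    (hΔ₀ : Δ₀.support.Finite) {α z' z : ℝ} (hz : z' < z)
    (H : ∀ b ∈ A.initialEdges η Δ₀, ∀ μ q, IsStationaryOn (A.stepWeight η) μ q →
      ∑ k, μ k * (Edge.disp k : ℝ) = A.shiftPeriod η * α →
      (∀ k, 0 < μ k → Accessible (A.stepWeight η) b k) →
      (∀ k l, 0 < μ k → 0 < μ l →
        Accessible (A.stepWeight η) k l ∨ Accessible (A.stepWeight η) l k) →
      ∑ k, ∑ l, μ k * q k l * Real.log (A.stepWeight η k l / q k l) < z') :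
    ∀ᶠ ε in 𝓝[>] (0 : ℝ), ∀ᶠ N : ℕ in atTop,
      A.defectMass η Δ₀ ((N + 1) * A.shiftPeriod η) (window α ε ((N + 1) * A.shiftPeriod η))
        ≤ ENNReal.ofReal (Real.exp (N * z)) := by
  classical
  set π := A.shiftPeriod η with hπ
  have hπ1 : 1 ≤ π := hη.shiftPeriod_spec.1
  have hπ0 : (0 : ℝ) < π := by exact_mod_cast hπ1
  set a : ℝ := π * α with ha
  set k := Fintype.card (A.Edge η × A.Edge η)
  have hex : ∀ b : A.Edge η, ∀ᶠ ε in 𝓝[>] (0 : ℝ), b ∈ A.initialEdges η Δ₀ →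
      ∀ᶠ N : ℕ in atTop,
      ((∑ p : PathTail (A.Edge η) N with |(pathDisp Edge.disp b p : ℝ) - N * a| ≤ ε * N,
        weight (A.stepWeight η) b p : ℕ) : ℝ) ≤ ((N : ℝ) + 1) ^ k * Real.exp (N * z') := by
    intro b
    by_cases hb : b ∈ A.initialEdges η Δ₀
    swap
    · exact Eventually.of_forall fun _ h => absurd h hb
    obtain ⟨ε₁, hε₁, h⟩ := eventually_sum_weight_le (H b hb)
    filter_upwards [Ioo_mem_nhdsGT hε₁] with ε hε _
    filter_upwards [h] with N hN
    refine le_trans ?_ hN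
    rw [Nat.cast_le]
    refine Finset.sum_le_sum_of_subset fun p hp => ?_
    rw [Finset.mem_filter] at hp ⊢
    exact ⟨hp.1, hp.2.trans (mul_le_mul_of_nonneg_right hε.2.le (Nat.cast_nonneg N))⟩
  obtain ⟨ε₀, hε₀, hpos⟩ := ((eventually_all.2 hex).and self_mem_nhdsWithin).exists
  have hpos' : 0 < ε₀ := hpos
  obtain ⟨M, hM⟩ := exists_disp_le A η hΔ₀.toFinset
  let S : ℕ := Finset.univ.sup fun e : A.Edge η => e.size
  have hS : ∀ e : A.Edge η, e.size ≤ S := fun e =>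
    Finset.le_sup (f := fun e : A.Edge η => e.size) (Finset.mem_univ e)
  let K : ℝ := ∑ i ∈ hΔ₀.toFinset, ∑ _b : A.Edge η, (Δ₀ i * S : ℝ)
  -- The window then has half-width below `(N + 1) ε₀ / 2`; the other half of `ε₀ N` absorbs the
  -- initial site, the last edge and the extra period.
  filter_upwards [Ioo_mem_nhdsGT (show 0 < ε₀ / (2 * π) by positivity)] with ε hε
  have hεπ : ε * π < ε₀ / 2 := by
    have := (lt_div_iff₀ (by positivity)).1 hε.2
    linarith
  have e1 : ∀ᶠ N : ℕ in atTop, (M : ℝ) + |a| + ε₀ / 2 ≤ N * (ε₀ / 2) :=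
    (tendsto_natCast_atTop_atTop.atTop_mul_const (half_pos hpos')).eventually_ge_atTop _
  have e2 : ∀ b : A.Edge η, ∀ᶠ N : ℕ in atTop, b ∈ A.initialEdges η Δ₀ →
      ((∑ p : PathTail (A.Edge η) N with |(pathDisp Edge.disp b p : ℝ) - N * a| ≤ ε₀ * N,
        weight (A.stepWeight η) b p : ℕ) : ℝ) ≤ ((N : ℝ) + 1) ^ k * Real.exp (N * z') := fun b => by
    by_cases hb : b ∈ A.initialEdges η Δ₀
    · exact (hε₀ b hb).mono fun _ h _ => h
    · exact Eventually.of_forall fun _ h => absurd h hb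
  filter_upwards [e1, eventually_all.2 e2, eventually_mul_pow_mul_exp_le K k hz] with N h1 h2 h3
  rw [hη.defectMass_eq (s := hΔ₀.toFinset) (fun y hy => by simpa using hy),
    ← ENNReal.ofReal_natCast]
  refine ENNReal.ofReal_le_ofReal (le_trans ?_ h3)
  simp only [K]
  rw [Nat.cast_sum, Finset.sum_mul]
  refine Finset.sum_le_sum fun i hi => ?_
  rw [Nat.cast_sum, Finset.sum_mul]
  refine Finset.sum_le_sum fun b _ => ?_
  by_cases hb : b.source = i % spatialPeriod η
  swap
  · simp only [hb, false_and, if_false, Finset.sum_const_zero, Nat.cast_zero]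
    positivity
  have hbi : b ∈ A.initialEdges η Δ₀ := ⟨i, by simpa using hi, hb⟩
  refine le_trans ?_ (mul_le_mul_of_nonneg_left (h2 b hbi) (by positivity))
  rw [← Nat.cast_mul, ← Nat.cast_mul, Nat.cast_le, Finset.sum_filter, Finset.mul_sum]
  refine Finset.sum_le_sum fun p _ => ?_
  by_cases hp : b.source = i % spatialPeriod η ∧
      i + (pathDisp Edge.disp b p + (last b p).disp) ∈ window α ε ((N + 1) * A.shiftPeriod η)
  swap
  · rw [if_neg hp]
    exact Nat.zero_le _
  have hw := (mem_window (Nat.mul_pos (Nat.add_one_pos N) hπ1)).1 hp.2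
  have hd : |(pathDisp Edge.disp b p : ℝ) - N * a| ≤ ε₀ * N := by
    have hM' : |(i : ℝ) + (last b p).disp| ≤ M := by exact_mod_cast hM i hi (last b p)
    push_cast at hw
    have e : (pathDisp Edge.disp b p : ℝ) - N * a
        = (i + (pathDisp Edge.disp b p + (last b p).disp) - (N + 1) * π * α) + a
          + -(i + (last b p).disp) := by
      rw [ha]; ring
    have t1 := abs_add_le ((i + (pathDisp Edge.disp b p + (last b p).disp) - (N + 1) * π * α) + a)
      (-((i : ℝ) + (last b p).disp))
    have t2 := abs_add_le ((i : ℝ) + (pathDisp Edge.disp b p + (last b p).disp) - (N + 1) * π * α) a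
    rw [abs_neg] at t1
    rw [e]
    have t3 : ε * ((N + 1) * π) ≤ (N + 1) * (ε₀ / 2) := by
      have : (0 : ℝ) ≤ N + 1 := by positivity
      nlinarith [mul_le_mul_of_nonneg_left hεπ.le this]
    linarith
  rw [if_pos hp, if_pos hd, mul_assoc, mul_comm S]
  exact Nat.mul_le_mul_left _ (Nat.mul_le_mul_left _ (hS _))

theorem IsDoublyPeriodic.eventually_le_defectMass (hη : A.IsDoublyPeriodic η)
    (hΔ₀ : Δ₀.support.Finite) {α z : ℝ} {b : A.Edge η} (hb : b ∈ A.initialEdges η Δ₀)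
    {μ : A.Edge η → ℝ} {q : A.Edge η → A.Edge η → ℝ} (h : IsStationaryOn (A.stepWeight η) μ q)
    (hα : ∑ k, μ k * (Edge.disp k : ℝ) = A.shiftPeriod η * α)
    (hbk : ∀ k, 0 < μ k → Accessible (A.stepWeight η) b k)
    (hcomp : ∀ k l, 0 < μ k → 0 < μ l →
        Accessible (A.stepWeight η) k l ∨ Accessible (A.stepWeight η) l k)
    (hz : z < ∑ k, ∑ l, μ k * q k l * Real.log (A.stepWeight η k l / q k l))
    {ε : ℝ} (hε : 0 < ε) :
    ∀ᶠ N : ℕ in atTop, ENNReal.ofReal (Real.exp (N * z)) ≤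
      A.defectMass η Δ₀ ((N + 1) * A.shiftPeriod η)
        (window α ε ((N + 1) * A.shiftPeriod η)) := by
  classical
  set π := A.shiftPeriod η with hπ
  have hπ1 : 1 ≤ π := hη.shiftPeriod_spec.1
  have hπ0 : (0 : ℝ) < π := by exact_mod_cast hπ1
  set a : ℝ := π * α with ha
  obtain ⟨i, hi, hbi⟩ := hb
  have his : i ∈ hΔ₀.toFinset := by simpa using hi
  obtain ⟨M, hM⟩ := exists_disp_le A η hΔ₀.toFinset
  have hεπ : 0 < ε * π / 2 := by positivity
  have e1 : ∀ᶠ N : ℕ in atTop, (M : ℝ) + |a| ≤ N * (ε * π / 2) :=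
    (tendsto_natCast_atTop_atTop.atTop_mul_const hεπ).eventually_ge_atTop _
  filter_upwards [e1, h.eventually_exists_walkWeight hbk hcomp hα hz hεπ] with N h1 h2
  obtain ⟨l, s, hs, hw⟩ := h2
  rw [hη.defectMass_eq (s := hΔ₀.toFinset) (fun y hy => by simpa using hy),
    ENNReal.ofReal_le_natCast]
  refine hw.trans (Nat.cast_le.2 ?_)
  -- One initial site and one initial edge suffice for a lower bound.
  refine le_trans ?_ (Finset.single_le_sum (fun _ _ => Nat.zero_le _) his)
  refine le_trans ?_ (Finset.single_le_sum (fun _ _ => Nat.zero_le _) (Finset.mem_univ b))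
  refine Finset.sum_le_sum fun p _ => ?_
  by_cases hp : last b p = l ∧ pathDisp Edge.disp b p = s
  swap
  · rw [if_neg hp]
    exact Nat.zero_le _
  have hmem : i + (pathDisp Edge.disp b p + (last b p).disp)
      ∈ window α ε ((N + 1) * A.shiftPeriod η) := by
    rw [mem_window (Nat.mul_pos (Nat.add_one_pos N) hπ1)]
    have hM' : |(i : ℝ) + (last b p).disp| ≤ M := by exact_mod_cast hM i his (last b p)
    rw [← hp.2] at hs
    push_cast
    have e : (i : ℝ) + (pathDisp Edge.disp b p + (last b p).disp) - (N + 1) * π * α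
        = (pathDisp Edge.disp b p - N * a) + -a + (i + (last b p).disp) := by
      rw [ha]; ring
    have t1 := abs_add_le ((pathDisp Edge.disp b p - N * a) + -a) ((i : ℝ) + (last b p).disp)
    have t2 := abs_add_le ((pathDisp Edge.disp b p : ℝ) - N * a) (-a)
    rw [abs_neg] at t2
    rw [e]
    have t3 : 0 < ε * π := by positivity
    linarith
  rw [if_pos hp, if_pos ⟨hbi, hmem⟩]
  have hsize : 1 ≤ (last b p).size := Nat.one_le_iff_ne_zero.2 (last b p).2
  have hΔ : 1 ≤ Δ₀ i := Nat.one_le_iff_ne_zero.2 hi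
  exact (Nat.le_mul_of_pos_right _ hsize).trans (Nat.le_mul_of_pos_left _ hΔ)

/-! ### From multiples of the period to all times -/

theorem exists_nbhd_le (A : CellularAutomaton) : ∃ R : ℕ, ∀ v ∈ A.nbhd, |v| ≤ R :=
  ⟨A.nbhd.sup Int.natAbs, fun v hv => by
    rw [Int.abs_eq_natAbs]
    exact_mod_cast Finset.le_sup (f := Int.natAbs) hv⟩

/-- An upper bound along the multiples of `π` implies one along all times. -/
theorem eventually_defectCount_le {π : ℕ} (hπ : 1 ≤ π) {α z u : ℝ} (hu : z / π < u)
    (H : ∀ᶠ ε in 𝓝[>] (0 : ℝ), ∀ᶠ N : ℕ in atTop,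
      A.defectMass η Δ₀ ((N + 1) * π) (window α ε ((N + 1) * π))
        ≤ ENNReal.ofReal (Real.exp (N * z))) :
    ∀ᶠ ε in 𝓝[>] (0 : ℝ), ∀ᶠ t : ℕ in atTop,
      A.defectCount η Δ₀ α ε t ≤ ENNReal.ofReal (Real.exp (t * u)) := by
  obtain ⟨ε₀, hε₀, hpos⟩ := (H.and self_mem_nhdsWithin).exists
  have hpos' : 0 < ε₀ := hpos
  have hπ0 : (0 : ℝ) < π := by exact_mod_cast hπ
  obtain ⟨R, hR⟩ := exists_nbhd_le A
  set C : ℕ := A.nbhd.card + 1 with hC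
  have hC1 : (1 : ℝ) ≤ C := by exact_mod_cast Nat.le_add_left 1 _
  have hlim : Tendsto (fun t : ℕ => t / π - 1) atTop atTop :=
    (tendsto_sub_atTop_nat 1).comp (Nat.tendsto_div_const_atTop (by omega))
  filter_upwards [Ioo_mem_nhdsGT (half_pos hpos')] with ε hε
  have e1 : ∀ᶠ t : ℕ in atTop,
      ((π * R : ℕ) : ℝ) + |α| * π + ε * π + ε₀ / 2 * π ≤ t * (ε₀ / 2) :=
    (tendsto_natCast_atTop_atTop.atTop_mul_const (half_pos hpos')).eventually_ge_atTop _
  have e2 : ∀ᶠ t : ℕ in atTop, π * Real.log C + 2 * |z| ≤ t * (u - z / π) :=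
    (tendsto_natCast_atTop_atTop.atTop_mul_const (sub_pos.2 hu)).eventually_ge_atTop _
  filter_upwards [e1, e2, hlim.eventually hε₀, eventually_ge_atTop π] with t h1 h2 h3 h4
  have hdiv : 1 ≤ t / π := (Nat.one_le_div_iff (by omega)).2 h4
  -- The last multiple of `π` up to `t` is `(N + 1) π`; defects are propagated forward from there.
  set N := t / π - 1 with hN
  set r := t % π with hr
  have ht : (N + 1) * π + r = t := by
    rw [hN, Nat.sub_add_cancel hdiv, mul_comm]
    exact Nat.div_add_mod t π
  have hrπ : r < π := Nat.mod_lt _ (by omega)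
  have hNR : (t : ℝ) = (N + 1) * π + r := by exact_mod_cast ht.symm
  have hrR : (r : ℝ) ≤ π := by exact_mod_cast hrπ.le
  have hmass := defectMass_add_le (η := η) (Δ₀ := Δ₀) hR ((N + 1) * π) r (U := window α ε t)
    (V := window α ε₀ ((N + 1) * π)) (by
      intro x hx y hy
      refine window_thickening (t := t) (p := π) (M := π * R) (by omega)
        (Nat.mul_pos (Nat.add_one_pos N) hπ) hε.1.le (by omega) (by omega) ?_ hx (hy.trans ?_)
      · push_cast at h1 ⊢
        have h5 : ε₀ / 2 * ((N + 1) * π) ≤ (ε₀ - ε) * ((N + 1) * π) :=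
          mul_le_mul_of_nonneg_right (by linarith [hε.2]) (by positivity)
        have h6 : ε₀ / 2 * r ≤ ε₀ / 2 * π := mul_le_mul_of_nonneg_left hrR (by linarith)
        rw [hNR] at h1
        linarith
      · push_cast
        gcongr)
  rw [ht] at hmass
  refine (hmass.trans (mul_le_mul_right h3 _)).trans ?_
  rw [← hC, ← ENNReal.ofReal_natCast, ← ENNReal.ofReal_pow (by positivity),
    ← ENNReal.ofReal_mul (by positivity)]
  refine ENNReal.ofReal_le_ofReal ?_
  have hCpow : (C : ℝ) ^ r ≤ Real.exp (π * Real.log C) := by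
    rw [Real.exp_nat_mul, Real.exp_log (by linarith)]
    exact pow_le_pow_right₀ hC1 hrπ.le
  refine (mul_le_mul_of_nonneg_right hCpow (Real.exp_pos _).le).trans ?_
  rw [← Real.exp_add]
  refine Real.exp_le_exp.2 ?_
  have e : (N : ℝ) * z = t * (z / π) - (1 + r / π) * z := by
    rw [hNR]
    field_simp
    ring
  have h5 : r / (π : ℝ) ≤ 1 := (div_le_one hπ0).2 hrR
  have h6 : -((1 + r / π) * z) ≤ 2 * |z| := by
    have h7 : (0 : ℝ) ≤ 1 + r / π := by positivity
    nlinarith [mul_le_mul_of_nonneg_left (neg_le_abs z) h7, abs_nonneg z]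
  linarith

/-- A lower bound along the multiples of `π` implies one along all times. -/
theorem eventually_le_defectCount {π : ℕ} (hπ : 1 ≤ π) {α z u : ℝ} (hu : u < z / π)
    (H : ∀ ε : ℝ, 0 < ε → ∀ᶠ N : ℕ in atTop, ENNReal.ofReal (Real.exp (N * z)) ≤
      A.defectMass η Δ₀ ((N + 1) * π) (window α ε ((N + 1) * π)))
    {ε : ℝ} (hε : 0 < ε) :
    ∀ᶠ t : ℕ in atTop, ENNReal.ofReal (Real.exp (t * u)) ≤ A.defectCount η Δ₀ α ε t := by
  have hπ0 : (0 : ℝ) < π := by exact_mod_cast hπ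
  obtain ⟨R, hR⟩ := exists_nbhd_le A
  set C : ℕ := A.nbhd.card + 1 with hC
  have hC1 : (1 : ℝ) ≤ C := by exact_mod_cast Nat.le_add_left 1 _
  have hlim : Tendsto (fun t : ℕ => t / π) atTop atTop :=
    Nat.tendsto_div_const_atTop (by omega)
  have e1 : ∀ᶠ t : ℕ in atTop,
      ((π * R : ℕ) : ℝ) + |α| * π + ε / 2 * π ≤ t * (ε / 2) :=
    (tendsto_natCast_atTop_atTop.atTop_mul_const (half_pos hε)).eventually_ge_atTop _
  have e2 : ∀ᶠ t : ℕ in atTop, π * Real.log C + |z| ≤ t * (z / π - u) :=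
    (tendsto_natCast_atTop_atTop.atTop_mul_const (sub_pos.2 hu)).eventually_ge_atTop _
  filter_upwards [e1, e2, hlim.eventually (H (ε / 2) (half_pos hε)), eventually_ge_atTop 1]
    with t h1 h2 h3 h4
  set N := t / π with hN
  have hmod : N * π + t % π = t := by
    rw [hN, mul_comm]
    exact Nat.div_add_mod t π
  have hmodlt : t % π < π := Nat.mod_lt _ (by omega)
  -- For a lower bound the comparison runs from `t` to the next multiple, which comes `π` later when
  -- `π` divides `t`.
  set r := π - t % π with hr
  have ht : t + r = (N + 1) * π := by
    rw [add_mul, one_mul]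
    omega
  have hrπ : r ≤ π := Nat.sub_le _ _
  have hmass := defectMass_add_le (η := η) (Δ₀ := Δ₀) hR t r
    (U := window α (ε / 2) ((N + 1) * π)) (V := window α ε t) (by
      intro x hx y hy
      refine window_thickening (t := (N + 1) * π) (p := π) (M := π * R)
        (Nat.mul_pos (Nat.add_one_pos N) hπ) (by omega) (half_pos hε).le (by omega) (by omega) ?_
        hx (hy.trans ?_)
      · rw [sub_half]
        linarith
      · push_cast
        gcongr)
  rw [ht] at hmass
  have hle := h3.trans hmass
  rw [← hC, ← ENNReal.ofReal_natCast, ← ENNReal.ofReal_pow (by positivity)] at hle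
  have hCr : 0 < (C : ℝ) ^ r := by positivity
  refine (ENNReal.mul_le_mul_iff_right (ENNReal.ofReal_pos.2 hCr).ne' ENNReal.ofReal_ne_top).1
    (le_trans ?_ hle)
  rw [← ENNReal.ofReal_mul hCr.le]
  refine ENNReal.ofReal_le_ofReal ?_
  have hCpow : (C : ℝ) ^ r ≤ Real.exp (π * Real.log C) := by
    rw [Real.exp_nat_mul, Real.exp_log (by linarith)]
    exact pow_le_pow_right₀ hC1 hrπ
  refine (mul_le_mul_of_nonneg_right hCpow (Real.exp_pos _).le).trans ?_
  rw [← Real.exp_add]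
  refine Real.exp_le_exp.2 ?_
  set m := t % π with hm
  have hNR : (t : ℝ) = N * π + m := by exact_mod_cast hmod.symm
  have hmR : (m : ℝ) ≤ π := by exact_mod_cast hmodlt.le
  have e : (N : ℝ) * z = t * (z / π) - m / π * z := by
    rw [hNR]
    field_simp
    ring
  have h5 : m / (π : ℝ) ≤ 1 := (div_le_one hπ0).2 hmR
  have h6 : m / π * z ≤ |z| := by
    have h7 : (0 : ℝ) ≤ m / π := by positivity
    nlinarith [mul_le_mul_of_nonneg_left (le_abs_self z) h7, abs_nonneg z]
  linarith

/-! ### From defect counts to growth rates -/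

theorem growthRate_le {α ε u : ℝ} {t : ℕ} (ht : 1 ≤ t)
    (h : A.defectCount η Δ₀ α ε t ≤ ENNReal.ofReal (Real.exp (t * u))) :
    A.growthRate η Δ₀ α ε t ≤ u := by
  have h1 := ENNReal.log_le_log h
  rw [ENNReal.log_ofReal_of_pos (Real.exp_pos _), Real.log_exp] at h1
  rw [growthRate, EReal.div_le_iff_le_mul (by exact_mod_cast ht) (EReal.natCast_ne_top t)]
  exact_mod_cast h1

theorem le_growthRate {α ε u : ℝ} {t : ℕ} (ht : 1 ≤ t)
    (h : ENNReal.ofReal (Real.exp (t * u)) ≤ A.defectCount η Δ₀ α ε t) :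
    u ≤ A.growthRate η Δ₀ α ε t := by
  have h1 := ENNReal.log_le_log h
  rw [ENNReal.log_ofReal_of_pos (Real.exp_pos _), Real.log_exp] at h1
  rw [growthRate, EReal.le_div_iff_mul_le (by exact_mod_cast ht) (EReal.natCast_ne_top t),
    mul_comm]
  exact_mod_cast h1

/-- Bounds on the numbers of defects determine both limits of the growth rate. -/
theorem tendsto_growthRate {α : ℝ} {L : EReal}
    (hle : ∀ u : ℝ, L < u → ∀ᶠ ε in 𝓝[>] (0 : ℝ), ∀ᶠ t : ℕ in atTop,
      A.defectCount η Δ₀ α ε t ≤ ENNReal.ofReal (Real.exp (t * u)))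
    (hge : ∀ u : ℝ, u < L → ∀ ε : ℝ, 0 < ε → ∀ᶠ t : ℕ in atTop,
      ENNReal.ofReal (Real.exp (t * u)) ≤ A.defectCount η Δ₀ α ε t) :
    Tendsto (fun ε : ℝ => limsup (A.growthRate η Δ₀ α ε) atTop) (𝓝[>] 0) (𝓝 L) ∧
      Tendsto (fun ε : ℝ => liminf (A.growthRate η Δ₀ α ε) atTop) (𝓝[>] 0) (𝓝 L) := by
  have hl : ∀ c < L, ∀ᶠ ε in 𝓝[>] (0 : ℝ), c < liminf (A.growthRate η Δ₀ α ε) atTop := by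
    intro c hc
    obtain ⟨u, hcu, huL⟩ := EReal.lt_iff_exists_real_btwn.1 hc
    filter_upwards [self_mem_nhdsWithin] with ε hε
    refine hcu.trans_le (le_liminf_of_le (by isBoundedDefault) ?_)
    filter_upwards [hge u huL ε hε, eventually_ge_atTop 1] with t h1 h2
    exact le_growthRate h2 h1
  have hu : ∀ c > L, ∀ᶠ ε in 𝓝[>] (0 : ℝ), limsup (A.growthRate η Δ₀ α ε) atTop < c := by
    intro c hc
    obtain ⟨u, hLu, huc⟩ := EReal.lt_iff_exists_real_btwn.1 hc
    filter_upwards [hle u hLu] with ε hε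
    refine (limsup_le_of_le (by isBoundedDefault) ?_).trans_lt huc
    filter_upwards [hε, eventually_ge_atTop 1] with t h1 h2
    exact growthRate_le h2 h1
  have hlu : ∀ ε : ℝ, liminf (A.growthRate η Δ₀ α ε) atTop
      ≤ limsup (A.growthRate η Δ₀ α ε) atTop := fun ε => liminf_le_limsup
  exact ⟨tendsto_order.2 ⟨fun c hc => (hl c hc).mono fun ε h => h.trans_le (hlu ε), hu⟩,
    tendsto_order.2 ⟨hl, fun c hc => (hu c hc).mono fun ε h => (hlu ε).trans_lt h⟩⟩

/-! ### The entropy as an extended real -/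

theorem coe_sum_ereal {ι : Type} (s : Finset ι) (f : ι → ℝ) :
    ((∑ i ∈ s, f i : ℝ) : EReal) = ∑ i ∈ s, (f i : EReal) := by
  classical
  induction s using Finset.induction_on with
  | empty => simp
  | insert i s hi ih => rw [Finset.sum_insert hi, Finset.sum_insert hi, EReal.coe_add, ih]

theorem sum_ereal_eq_bot {ι : Type} {s : Finset ι} {f : ι → EReal} {i : ι} (hi : i ∈ s)
    (h : f i = ⊥) : ∑ i ∈ s, f i = ⊥ := by
  classical
  rw [← Finset.add_sum_erase s f hi, h, EReal.bot_add]

theorem entropy_eq {q : Matrix (A.Edge η) (A.Edge η) ℝ} {μ : A.Edge η → ℝ}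
    (h : ∀ k l, μ k * q k l ≠ 0 → A.stepWeight η k l ≠ 0) :
    A.entropy η q μ
      = ((∑ k, ∑ l, μ k * q k l * Real.log (A.stepWeight η k l / q k l) : ℝ) : EReal) := by
  simp only [entropy, coe_sum_ereal]
  refine Finset.sum_congr rfl fun k _ => Finset.sum_congr rfl fun l _ => ?_
  split_ifs with h1 h2
  · simp [h1]
  · exact absurd h2 (h k l h1)
  · rfl

/-- Kernels with forbidden steps thus never exceed a real number, and only chains supported on `T`
matter for the supremum. -/
theorem entropy_eq_bot {q : Matrix (A.Edge η) (A.Edge η) ℝ} {μ : A.Edge η → ℝ}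
    {k l : A.Edge η} (h : μ k * q k l ≠ 0) (h' : A.stepWeight η k l = 0) :
    A.entropy η q μ = ⊥ :=
  sum_ereal_eq_bot (Finset.mem_univ k) (sum_ereal_eq_bot (Finset.mem_univ l) (by
    rw [if_neg h]
    exact if_pos h'))

end CellularAutomaton

/-! ### The Lyapunov profile -/

open CellularAutomaton

theorem mainTheorem2 (A : CellularAutomaton) (η : ℤ → Bool) (hη : A.IsDoublyPeriodic η)
    (Δ₀ : ℤ → ℕ) (hΔ₀ : Δ₀.support.Finite) :
    A.IsProper η Δ₀ ∧
      A.HasLyapunovProfile η Δ₀ (fun α : ℝ =>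
        (⨆ b ∈ A.initialEdges η Δ₀,
          ⨆ μ ∈ A.edgeDistributions η ((A.shiftPeriod η : ℝ) * α) ∩ A.reachable η b,
          ⨆ q ∈ A.invariantKernels η μ, A.entropy η q μ) / (A.shiftPeriod η : EReal)) := by
  set π := A.shiftPeriod η with hπ
  have hπ1 : 1 ≤ π := hη.shiftPeriod_spec.1
  have hπ0 : (0 : ℝ) < π := by exact_mod_cast hπ1
  have hπE : (0 : EReal) < π := by exact_mod_cast hπ1
  have hπT : (π : EReal) ≠ ⊤ := EReal.natCast_ne_top π
  have key : ∀ α : ℝ, _ := fun α => tendsto_growthRate (A := A) (η := η) (Δ₀ := Δ₀) (α := α)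
    (L := (⨆ b ∈ A.initialEdges η Δ₀,
          ⨆ μ ∈ A.edgeDistributions η ((A.shiftPeriod η : ℝ) * α) ∩ A.reachable η b,
          ⨆ q ∈ A.invariantKernels η μ, A.entropy η q μ) / (A.shiftPeriod η : EReal)) ?_ ?_
  · exact ⟨fun α => ⟨_, key α⟩, fun α => (key α).1⟩
  · intro u hu
    rw [EReal.div_lt_iff hπE hπT] at hu
    -- Two gaps are needed: from `z'` to `z` for the polynomial factors, from `z` to `u * π` for the
    -- times between multiples of `π`. An empty supremum needs no separate case, as the condition on
    -- chains is then vacuous.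
    obtain ⟨z', hz', hzu⟩ := EReal.lt_iff_exists_real_btwn.1 hu
    have hzu' : z' < u * π := by exact_mod_cast hzu
    obtain ⟨z, hz1, hz2⟩ := exists_between hzu'
    refine eventually_defectCount_le hπ1 ((div_lt_iff₀ hπ0).2 hz2)
      (hη.eventually_defectMass_le hΔ₀ hz1 ?_)
    intro b hb μ q h hα hbk hcomp
    have hent := entropy_eq (A := A) (η := η) (q := q) (μ := μ) h.positive
    rw [← EReal.coe_lt_coe_iff, ← hent]
    refine lt_of_le_of_lt ?_ hz'
    refine le_iSup₂_of_le b hb (le_iSup₂_of_le μ ⟨⟨h.nonneg, h.sum_eq_one, hα⟩, ?_⟩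
      (le_iSup₂_of_le q ⟨h.kernel_nonneg, h.kernel_sum, h.invariant⟩ le_rfl))
    refine fun k l => ⟨fun hk => ?_, fun h1 h2 => ?_⟩
    · by_contra h0
      exact hk (hbk k ((h.nonneg k).lt_of_ne' h0))
    · by_contra h0
      rcases hcomp k l ((h.nonneg k).lt_of_ne' (left_ne_zero_of_mul h0))
        ((h.nonneg l).lt_of_ne' (right_ne_zero_of_mul h0)) with h3 | h3
      · exact h2 h3
      · exact h1 h3
  · intro u hu ε hε
    rw [EReal.lt_div_iff hπE hπT] at hu
    obtain ⟨z, hzu, hz⟩ := EReal.lt_iff_exists_real_btwn.1 hu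
    have hzu' : u * π < z := by exact_mod_cast hzu
    obtain ⟨b, hz⟩ := lt_iSup_iff.1 hz
    obtain ⟨hb, hz⟩ := lt_iSup_iff.1 hz
    obtain ⟨μ, hz⟩ := lt_iSup_iff.1 hz
    obtain ⟨⟨hμ, hreach⟩, hz⟩ := lt_iSup_iff.1 hz
    obtain ⟨q, hz⟩ := lt_iSup_iff.1 hz
    obtain ⟨hq, hz⟩ := lt_iSup_iff.1 hz
    have hT : ∀ k l, μ k * q k l ≠ 0 → A.stepWeight η k l ≠ 0 := fun k l hkl h0 => by
      rw [entropy_eq_bot hkl h0] at hz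
      exact not_lt_bot hz
    rw [entropy_eq hT, EReal.coe_lt_coe_iff] at hz
    have hst : IsStationaryOn (A.stepWeight η) μ q := ⟨hq.1, hq.2.1, hμ.1, hμ.2.1, hq.2.2, hT⟩
    refine eventually_le_defectCount hπ1 ((lt_div_iff₀ hπ0).2 hzu') (fun ε' hε' =>
      hη.eventually_le_defectMass hΔ₀ hb hst hμ.2.2 (fun k hk => ?_) (fun k l hk hl => ?_) hz hε')
      hε
    · by_contra h0
      exact hk.ne' ((hreach k k).1 h0)
    · by_contra! h0
      exact (mul_pos hk hl).ne' ((hreach k l).2 h0.2 h0.1)
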